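/- **Setting.** Let $E$ be a finite set and let $f:2^E\to\mathbb{R}_{\ge 0}$ be a polymatroid, i.e. $f(\emptyset)=0$ and $f(A)\le f(A\cup B)\le f(A)+f(B)-f(A\cap B)$ for all $A,B\subseteq E$. Its polytope is $P_f=\{x\in\mathbb{R}^E : x\ge 0,\ \sum_{e\in A}x_e\le f(A)\text{ for all }A\subseteq E\}$. Let $\mathbf 1(x)=\sum_{e\in E}x_e$, and assume that $\mathbf 1$ is not constant on $P_f$ (equivalently, $f(E)>0$). For $P\subseteq\mathbb{R}^d$ and $w\in\mathbb{R}^d$ let $P^w$ be the set of maximizers of $\langle w,\cdot\rangle$ over $P$; the faces of $P$ are the sets $P^w$ (so for a polytope these are its nonempty faces, including $P$). Let $P$ be a polytope and $c$ a linear function that is not constant on $P$; put $P_{\min}=P^{-c}$, $P_{\max}=P^{c}$. * A *$c$-cellular string* on $P$ is a sequence $(F_0,\dots,F_r)$, $r\ge 0$, of faces of $P$ such that $c$ is not constant on any $F_i$, $F_0^{-c}\subseteq P_{\min}$, $F_r^{c}\subseteq P_{\max}$, and $F_i^{c}=F_i\cap F_{i+1}=F_{i+1}^{-c}$ for $0\le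 i<r$. The *Baues poset* $\mathrm{Baues}(P,c)$ is the set of all $c$-cellular strings, where $F\le G$ if $F$ is obtained from $G$ by replacing each $G_i$ by a $c$-cellular string on $G_i$ (possibly $(G_i)$ itself). * For $w\in\mathbb{R}^d$ let $\pi(x)=(\langle c,x\rangle,\langle w,x\rangle)$. The upper hull of $\pi(P)$ is the set of $(s,t)\in\pi(P)$ with $(s,t+\varepsilon)\notin\pi(P)$ for all $\varepsilon>0$. A cellular string is *coherent* if, for some $w$, its members are exactly the preimages in $P$ under $\pi$ of the edges of the upper hull. * A *$c$-monotone path* on $P$ is a sequence $(v_0,\dots,v_k)$ where $v_0$ is a vertex of $P_{\min}$, $v_k$ is a vertex of $P_{\max}$, and each $[v_i,v_{i+1}]$ is an edge of $P$ with $\langle c,v_i\rangle<\langle c,v_{i+1}\rangle$. * With $I=\{\langle c,x\rangle:x\in P\}$, the *monotone path polytope* is $\Sigma_c(P)=\{2\int_I\gamma\,ds\}$, where $\gamma$ ranges over all continuous maps $\gamma:I\to P$ with $\langle c,\gamma(s)\rangle=s$ for all $s\in I$. * A *greedy path* on $P_f$ arises as follows. Let $w\in\mathbb{R}^E$ have pairwise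 distinct entries and let $v$ be the greedy vertex $v_e=f(\{d:w_d\ge w_e\})-f(\{d:w_d>w_e\})$. List the support $\{e:v_e>0\}$ as $j_1,\dots,j_k$ with $w_{j_1}>\dots>w_{j_k}$ and put $F_i=\overline{\{j_1,\dots,j_i\}}$, where $\overline A=\{e: f(A\cup e)=f(A)\}$. The path is $v_0,\dots,v_k$ with $(v_i)_{j_h}=f(F_h)-f(F_{h-1})$ for $h\le i$ and all other coordinates $0$. **Theorem.** Let $(E,f)$ be a polymatroid such that $\mathbf 1$ is not constant on $P_f$. Then every $\mathbf 1$-cellular string on $P_f$ is coherent, and every $\mathbf 1$-monotone path on $P_f$ is a greedy path. Moreover, the Baues poset $\mathrm{Baues}(P_f,\mathbf 1)$ is isomorphic to the poset of nonempty faces of the monotone path polytope $\Sigma_{\mathbf 1}(P_f)$, ordered by inclusion. -/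

import Mathlib

namespace MonotonePaths

open MeasureTheory

/-! ### Faces of polytopes in `ℝ^ι`

Linear functions on `ι → ℝ` are given by vectors `w` through the dot product. -/

section Polytopes

variable {ι : Type*} [Fintype ι]

/-- The face `P^w` of `P` in direction `w`: the set of maximizers of `w` over `P`. -/
def maxFace (P : Set (ι → ℝ)) (w : ι → ℝ) : Set (ι → ℝ) :=
  {x | x ∈ P ∧ ∀ y ∈ P, w ⬝ᵥ y ≤ w ⬝ᵥ x}

/-- The face `P^{-w}` of minimizers of `w` over `P`. -/
def minFace (P : Set (ι → ℝ)) (w : ι → ℝ) : Set (ι → ℝ) :=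
  maxFace P (-w)

/-- Faces are the sets `P^w`. For a nonempty polytope `P`, these are exactly its nonempty faces,
`P` itself included (`w = 0`). -/
def IsFace (P F : Set (ι → ℝ)) : Prop :=
  ∃ w : ι → ℝ, F = maxFace P w

/-- The face lattice of `P` (without the empty face), ordered by inclusion. -/
abbrev Faces (P : Set (ι → ℝ)) : Type _ :=
  {F : Set (ι → ℝ) // IsFace P F}

/-- The linear function `c` is not constant on `P`. -/
def NotConstantOn (c : ι → ℝ) (P : Set (ι → ℝ)) : Prop :=
  ∃ x ∈ P, ∃ y ∈ P, c ⬝ᵥ x ≠ c ⬝ᵥ y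

/-! ### Cellular strings and the Baues poset -/

/-- A cellular string of `(P, c)`: a nonempty sequence `F_0, …, F_r` of faces of `P` on which `c`
is not constant, such that `F_0^{-c} ⊆ P_min`, `F_r^c ⊆ P_max` and
`F_i^c = F_i ∩ F_{i+1} = F_{i+1}^{-c}` for all `i < r`. -/
structure IsCellularString (P : Set (ι → ℝ)) (c : ι → ℝ) (F : List (Set (ι → ℝ))) : Prop where
  ne_nil : F ≠ []
  isFace : ∀ G ∈ F, IsFace P G
  notConstant : ∀ G ∈ F, NotConstantOn c G
  first : minFace (F.head ne_nil) c ⊆ minFace P c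
  last : maxFace (F.getLast ne_nil) c ⊆ maxFace P c
  chain : F.IsChain fun G H => maxFace G c = G ∩ H ∧ G ∩ H = minFace H c

/-- `F` refines `G` if `F` arises from `G` by replacing each `G_i` by a cellular string of
`(G_i, c)`. (Replacing `G_i` by the one-term string `G_i` leaves it as it is.) -/
def Refines (c : ι → ℝ) (F G : List (Set (ι → ℝ))) : Prop :=
  ∃ L : List (List (Set (ι → ℝ))),
    List.Forall₂ (fun C S => IsCellularString C c S) G L ∧ F = L.flatten

/-- The Baues poset of `(P, c)`: all cellular strings, ordered by refinement. -/
def Baues (P : Set (ι → ℝ)) (c : ι → ℝ) : Type _ :=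
  {F : List (Set (ι → ℝ)) // IsCellularString P c F}

instance (P : Set (ι → ℝ)) (c : ι → ℝ) : LE (Baues P c) :=
  ⟨fun F G => Refines c F.1 G.1⟩

/-! ### Coherent cellular strings -/

/-- The projection `x ↦ (⟨c, x⟩, ⟨w, x⟩)` to the plane. -/
def proj (c w : ι → ℝ) (x : ι → ℝ) : Fin 2 → ℝ :=
  ![c ⬝ᵥ x, w ⬝ᵥ x]

/-- The points `(s, t)` of `Q` such that `(s, t + ε) ∉ Q` for all `ε > 0`. -/
def upperHull (Q : Set (Fin 2 → ℝ)) : Set (Fin 2 → ℝ) :=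
  {p | p ∈ Q ∧ ∀ ε : ℝ, 0 < ε → ![p 0, p 1 + ε] ∉ Q}

/-- The edges of the upper hull of a (possibly degenerate) convex polygon `Q`: the faces of `Q`
that lie in the upper hull and are not single points. -/
def IsUpperEdge (Q e : Set (Fin 2 → ℝ)) : Prop :=
  IsFace Q e ∧ e ⊆ upperHull Q ∧ e.Nontrivial

/-- `F` is the coherent cellular string of `(P, c)` with respect to `w`: the cellular string whose
members are the preimages in `P` of the edges of the upper hull of the projection of `P` under
`(c, w)`. The order of the members in a cellular string is determined, as the values of `c`
increase. -/
def IsCoherentFor (P : Set (ι → ℝ)) (c w : ι → ℝ) (F : List (Set (ι → ℝ))) : Prop :=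
  IsCellularString P c F ∧
    ∀ C : Set (ι → ℝ), C ∈ F ↔ ∃ e, IsUpperEdge (proj c w '' P) e ∧ C = P ∩ proj c w ⁻¹' e

/-- `F` is a coherent cellular string of `(P, c)`. -/
def IsCoherent (P : Set (ι → ℝ)) (c : ι → ℝ) (F : List (Set (ι → ℝ))) : Prop :=
  ∃ w : ι → ℝ, IsCoherentFor P c w F

/-! ### Monotone paths and the monotone path polytope -/

/-- A `c`-monotone path `v_0, …, v_k` on `P`: `v_0` is a vertex of `P_min`, `v_k` is a vertex of
`P_max`, and every `[v_i, v_{i+1}]` is an edge of `P` along which `c` strictly increases. -/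
structure IsMonotonePath (P : Set (ι → ℝ)) (c : ι → ℝ) (v : List (ι → ℝ)) : Prop where
  ne_nil : v ≠ []
  first : IsFace (minFace P c) {v.head ne_nil}
  last : IsFace (maxFace P c) {v.getLast ne_nil}
  chain : v.IsChain fun x y => IsFace P (segment ℝ x y) ∧ c ⬝ᵥ x < c ⬝ᵥ y

/-- The range of values `I = {⟨c, x⟩ : x ∈ P}`. -/
def valueRange (P : Set (ι → ℝ)) (c : ι → ℝ) : Set ℝ :=
  (fun x => c ⬝ᵥ x) '' P

/-- A section of `(P, c)`: a continuous map `γ : I → P` with `⟨c, γ s⟩ = s`. Values of `γ` outside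
`I` are irrelevant. -/
structure IsSection (P : Set (ι → ℝ)) (c : ι → ℝ) (γ : ℝ → ι → ℝ) : Prop where
  continuousOn : ContinuousOn γ (valueRange P c)
  mem : ∀ s ∈ valueRange P c, γ s ∈ P
  value : ∀ s ∈ valueRange P c, c ⬝ᵥ γ s = s

/-- The monotone path polytope `{2 ∫_I γ ds : γ section}`. -/
noncomputable def monotonePathPolytope (P : Set (ι → ℝ)) (c : ι → ℝ) : Set (ι → ℝ) :=
  {x | ∃ γ : ℝ → ι → ℝ, IsSection P c γ ∧ x = (2 : ℝ) • ∫ s in valueRange P c, γ s}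

end Polytopes

/-! ### Polymatroids and greedy paths -/

section Polymatroids

variable {E : Type*} [Fintype E] [DecidableEq E]

/-- A polymatroid on `E`: a monotone submodular function `2^E → ℝ` vanishing on the empty set
(so that it is nonnegative). -/
structure IsPolymatroid (f : Finset E → ℝ) : Prop where
  empty : f ∅ = 0
  mono : ∀ A B : Finset E, f A ≤ f (A ∪ B)
  submodular : ∀ A B : Finset E, f (A ∪ B) ≤ f A + f B - f (A ∩ B)

/-- The polymatroid polytope `P_f`. -/
def polytope (f : Finset E → ℝ) : Set (E → ℝ) :=
  {x | (∀ e, 0 ≤ x e) ∧ ∀ A : Finset E, ∑ e ∈ A, x e ≤ f A}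

/-- The closure of `A`: all `e` with `f (A ∪ e) = f A`. -/
noncomputable def flatClosure (f : Finset E → ℝ) (A : Finset E) : Finset E :=
  {e | f (insert e A) = f A}

/-- The vertex of the base polytope found by the greedy algorithm for a weight `w` with pairwise
distinct entries: `x_e = f (A ∪ e) - f A`, where `A` is the set of elements of weight larger
than that of `e`. -/
noncomputable def greedyVertex (f : Finset E → ℝ) (w : E → ℝ) : E → ℝ :=
  fun e => f ({d | w e ≤ w d} : Finset E) - f ({d | w e < w d} : Finset E)

/-- The closure `F_i` of `{j_1, …, j_i}`. -/
noncomputable def greedyFlat (f : Finset E → ℝ) (j : List E) (i : ℕ) : Finset E :=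
  flatClosure f (j.take i).toFinset

/-- The point `v_i` of the sequence defined by `j = (j_1, …, j_k)`: its coordinate at `j_h` is
`f (F_h) - f (F_{h-1})` for `h ≤ i`, and all others vanish. (`j.idxOf e = h - 1` if `e = j_h`.) -/
noncomputable def greedyPoint (f : Finset E → ℝ) (j : List E) (i : ℕ) : E → ℝ :=
  fun e =>
    if e ∈ j.take i then
      f (greedyFlat f j (j.idxOf e + 1)) - f (greedyFlat f j (j.idxOf e))
    else 0

/-- A greedy path of `P_f`: for some weight `w` with pairwise distinct entries, `j_1, …, j_k` is
the support of the greedy vertex for `w`, listed by decreasing weight, and the path is the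
corresponding sequence `v_0, …, v_k`. -/
def IsGreedyPath (f : Finset E → ℝ) (v : List (E → ℝ)) : Prop :=
  ∃ w : E → ℝ, Function.Injective w ∧
    ∃ j : List E, (∀ e, e ∈ j ↔ 0 < greedyVertex f w e) ∧
      j.Pairwise (fun a b => w b < w a) ∧
      v = (List.range (j.length + 1)).map (greedyPoint f j)

end Polymatroids

end MonotonePaths

open MonotonePaths

/-!
**Polymatroids.** The engine is `IsPolymatroid.exists_le_sum_eq`: every point of `P_f` supported on
`T` lies below one supported on `T` with coordinate sum `f T`. Hence the coordinate sum on the face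
`P^u` ranges from `f {u > 0}` to `f {u ≥ 0}`, its minimal points are the restrictions of its points
to `{u > 0}`, and a face is determined by its minimal points together with its support. Therefore
the supports `T_0, …, T_r` of the members of a cellular string determine the string: the `i`-th
member consists of the points of `P_f` that attain the bound `f T_j` for `j < i` and vanish off
`T_j` for `j ≥ i` (`IsPolymatroid.mem_member_iff`). For the direction `w` that counts, with a minus
sign, the supports not containing a given element, these are exactly the maximizers of `w + i`.
So every cellular string consists of faces `P^(w + t)` for a single `w`
(`IsPolymatroid.exists_hasSlopes`). Conversely, the level sets of any `w` give a cellular string of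
such faces (`IsPolymatroid.exists_isCellularString`).

**Coherence and the Baues poset.** What follows from the faces `P^(w + t c)` is not special to
polymatroids. The points of `P` over the upper hull of the projection under `(c, w)` are exactly
those in the union of the string, which gives coherence (`IsCellularString.isCoherentFor`). A
section of `c` maximizes `w` after integration exactly if it maximizes `w` in every fibre, that is,
if it stays in this union, so the face of the monotone path polytope in direction `w` is formed by
the sections inside the string. As there are such sections through every point of the union,
inclusion of faces is inclusion of unions, and this is refinement: a face contained in a finite
union of faces is contained in one of them, and the values of `c` sort the members of the finer
string into consecutive blocks (`nonempty_baues_orderIso`).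

**Monotone paths.** An edge of `P_f` along which the coordinate sum increases raises a single
coordinate from `0`, to its greedy value (`IsPolymatroid.exists_of_isFace_segment`). A monotone path
is therefore given by the list of coordinates it raises, and any weight that decreases along this
list, with all other elements at the end, makes it greedy.
-/

namespace MonotonePaths

open MeasureTheory

/-! ### Faces of compact convex sets -/

section Faces

variable {ι : Type*} [Fintype ι] {P C G : Set (ι → ℝ)} {c w : ι → ℝ} {a b : ℝ}

theorem maxFace_subset : maxFace P w ⊆ P := fun _ h => h.1

theorem IsFace.subset (h : IsFace P G) : G ⊆ P := by
  obtain ⟨w, rfl⟩ := h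
  exact maxFace_subset

theorem continuous_dotProduct_left (w : ι → ℝ) : Continuous fun x : ι → ℝ => w ⬝ᵥ x := by
  unfold dotProduct
  fun_prop

theorem maxFace_nonempty (hP : IsCompact P) (h0 : P.Nonempty) (w : ι → ℝ) :
    (maxFace P w).Nonempty := by
  obtain ⟨x, hx, h⟩ := hP.exists_isMaxOn h0 (continuous_dotProduct_left w).continuousOn
  exact ⟨x, hx, fun y hy => h hy⟩

theorem isCompact_maxFace (hP : IsCompact P) (w : ι → ℝ) : IsCompact (maxFace P w) := by
  have : maxFace P w = P ∩ ⋂ y ∈ P, {x | w ⬝ᵥ y ≤ w ⬝ᵥ x} := by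
    ext
    simp [maxFace]
  rw [this]
  exact hP.inter_right (isClosed_biInter fun y _ =>
    isClosed_le continuous_const (continuous_dotProduct_left w))

theorem convex_maxFace (hP : Convex ℝ P) (w : ι → ℝ) : Convex ℝ (maxFace P w) := by
  intro x hx y hy r s hr hs hrs
  refine ⟨hP hx.1 hy.1 hr hs hrs, fun z hz => ?_⟩
  rw [dotProduct_add, dotProduct_smul, dotProduct_smul, smul_eq_mul, smul_eq_mul]
  calc w ⬝ᵥ z = r * (w ⬝ᵥ z) + s * (w ⬝ᵥ z) := by rw [← add_mul, hrs, one_mul]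
    _ ≤ _ := add_le_add (mul_le_mul_of_nonneg_left (hx.2 z hz) hr)
      (mul_le_mul_of_nonneg_left (hy.2 z hz) hs)

theorem IsFace.isCompact (hP : IsCompact P) (h : IsFace P G) : IsCompact G := by
  obtain ⟨w, rfl⟩ := h
  exact isCompact_maxFace hP w

theorem IsFace.convex (hP : Convex ℝ P) (h : IsFace P G) : Convex ℝ G := by
  obtain ⟨w, rfl⟩ := h
  exact convex_maxFace hP w

theorem IsFace.nonempty (hP : IsCompact P) (h0 : P.Nonempty) (h : IsFace P G) : G.Nonempty := by
  obtain ⟨w, rfl⟩ := h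
  exact maxFace_nonempty hP h0 w

/-- Faces are extreme sets. -/
theorem IsFace.mem_of_combo_mem (h : IsFace P G) {x y : ι → ℝ} (hx : x ∈ P) (hy : y ∈ P)
    {r s : ℝ} (hr : 0 < r) (hs : 0 ≤ s) (hrs : r + s = 1) (hz : r • x + s • y ∈ G) : x ∈ G := by
  obtain ⟨w, rfl⟩ := h
  have h1 := hz.2 y hy
  have h2 := hz.2 x hx
  rw [dotProduct_add, dotProduct_smul, dotProduct_smul, smul_eq_mul, smul_eq_mul] at h1 h2
  have hxy : w ⬝ᵥ y ≤ w ⬝ᵥ x := by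
    obtain rfl : s = 1 - r := by linarith
    nlinarith
  refine ⟨hx, fun z hz' => (hz.2 z hz').trans ?_⟩
  rw [dotProduct_add, dotProduct_smul, dotProduct_smul, smul_eq_mul, smul_eq_mul]
  obtain rfl : s = 1 - r := by linarith
  nlinarith

theorem isFace_of_subset (hP : IsCompact P) (h0 : P.Nonempty) (hC : IsFace P C) (hCG : C ⊆ G)
    (hGP : G ⊆ P) : IsFace G C := by
  obtain ⟨x, hx⟩ := hC.nonempty hP h0
  obtain ⟨w, rfl⟩ := hC
  refine ⟨w, Set.Subset.antisymm (fun y hy => ⟨hCG hy, fun z hz => hy.2 z (hGP hz)⟩)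
    fun y hy => ⟨hGP hy.1, fun z hz => (hx.2 z hz).trans (hy.2 x (hCG hx))⟩⟩

/-- A convex subset of a finite union of faces lies in one of them: otherwise, averaging points
outside the individual faces gives a point outside all of them. -/
theorem exists_subset_of_subset_iUnion {L : List (Set (ι → ℝ))} (hL : ∀ G ∈ L, IsFace P G)
    (hC : Convex ℝ C) (h0 : C.Nonempty) (hCP : C ⊆ P) (h : ∀ x ∈ C, ∃ G ∈ L, x ∈ G) :
    ∃ G ∈ L, C ⊆ G := by
  by_contra! hno
  have key : ∀ L' : List (Set (ι → ℝ)), (∀ G ∈ L', G ∈ L) → ∃ x ∈ C, ∀ G ∈ L', x ∉ G := by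
    intro L'
    induction L' with
    | nil => exact fun _ => ⟨h0.some, h0.some_mem, by simp⟩
    | cons G L' ih =>
      intro hsub
      obtain ⟨x, hx, hxL⟩ := ih fun H hH => hsub H (List.mem_cons_of_mem _ hH)
      obtain ⟨y, hy, hyG⟩ := Set.not_subset.1 (hno G (hsub G List.mem_cons_self))
      refine ⟨(1 / 2 : ℝ) • x + (1 / 2 : ℝ) • y,
        hC hx hy (by norm_num) (by norm_num) (by norm_num), fun H hH hz => ?_⟩
      rcases List.mem_cons.1 hH with rfl | hH'
      · rw [add_comm] at hz
        exact hyG ((hL H (hsub H hH)).mem_of_combo_mem (hCP hy) (hCP hx) (by norm_num)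
          (by norm_num) (by norm_num) hz)
      · exact hxL H hH' ((hL H (hsub H hH)).mem_of_combo_mem (hCP hx) (hCP hy) (by norm_num)
          (by norm_num) (by norm_num) hz)
  obtain ⟨x, hx, hxL⟩ := key L fun _ h => h
  obtain ⟨G, hG, hxG⟩ := h x hx
  exact hxL G hG hxG

/-! ### Ranges of a linear function and consecutive ranges -/

/-- The linear function `c` attains its minimum `a` and its maximum `b` on `G`. -/
def HasRange (c : ι → ℝ) (G : Set (ι → ℝ)) (a b : ℝ) : Prop :=
  IsLeast (valueRange G c) a ∧ IsGreatest (valueRange G c) b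

theorem HasRange.le (h : HasRange c G a b) {x : ι → ℝ} (hx : x ∈ G) : a ≤ c ⬝ᵥ x :=
  h.1.2 ⟨x, hx, rfl⟩

theorem HasRange.ge (h : HasRange c G a b) {x : ι → ℝ} (hx : x ∈ G) : c ⬝ᵥ x ≤ b :=
  h.2.2 ⟨x, hx, rfl⟩

theorem exists_hasRange (c : ι → ℝ) (hG : IsCompact G) (h0 : G.Nonempty) :
    ∃ a b, HasRange c G a b := by
  have hK : IsCompact (valueRange G c) := hG.image (continuous_dotProduct_left c)
  have hN : (valueRange G c).Nonempty := h0.image _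
  exact ⟨_, _, hK.isLeast_sInf hN, hK.isGreatest_sSup hN⟩

theorem HasRange.mem_minFace (h : HasRange c G a b) {x : ι → ℝ} :
    x ∈ minFace G c ↔ x ∈ G ∧ c ⬝ᵥ x = a := by
  obtain ⟨⟨y, hy, hya⟩, hle⟩ := h.1
  simp only [minFace, maxFace, neg_dotProduct, neg_le_neg_iff, Set.mem_ofPred_eq]
  refine and_congr_right fun hx => ⟨fun h' => le_antisymm (hya ▸ h' y hy) (h.le hx), ?_⟩
  rintro h' z hz
  exact h' ▸ h.le hz

theorem HasRange.mem_maxFace (h : HasRange c G a b) {x : ι → ℝ} :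
    x ∈ maxFace G c ↔ x ∈ G ∧ c ⬝ᵥ x = b := by
  obtain ⟨⟨y, hy, hya⟩, hle⟩ := h.2
  simp only [maxFace, Set.mem_ofPred_eq]
  refine and_congr_right fun hx => ⟨fun h' => le_antisymm (h.ge hx) (hya ▸ h' y hy), ?_⟩
  rintro h' z hz
  exact h' ▸ h.ge hz

theorem HasRange.exists_minFace (h : HasRange c G a b) : ∃ x, x ∈ minFace G c := by
  obtain ⟨⟨y, hy, hya⟩, -⟩ := h.1
  exact ⟨y, h.mem_minFace.2 ⟨hy, hya⟩⟩

theorem HasRange.exists_maxFace (h : HasRange c G a b) : ∃ x, x ∈ maxFace G c := by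
  obtain ⟨⟨y, hy, hya⟩, -⟩ := h.2
  exact ⟨y, h.mem_maxFace.2 ⟨hy, hya⟩⟩

theorem HasRange.notConstantOn_iff (h : HasRange c G a b) : NotConstantOn c G ↔ a < b := by
  constructor
  · rintro ⟨x, hx, y, hy, hxy⟩
    have := h.le hx
    have := h.ge hx
    have := h.le hy
    have := h.ge hy
    by_contra! hba
    exact hxy (by linarith)
  · intro hab
    obtain ⟨⟨x, hx, hxa⟩, -⟩ := h.1
    obtain ⟨⟨y, hy, hyb⟩, -⟩ := h.2
    exact ⟨x, hx, y, hy, fun h' => hab.ne (by rw [← hxa, ← hyb]; exact h')⟩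

theorem HasRange.valueRange_eq (h : HasRange c G a b) (hG : Convex ℝ G) :
    valueRange G c = Set.Icc a b := by
  refine Set.Subset.antisymm (fun s hs => ⟨h.1.2 hs, h.2.2 hs⟩) ?_
  have hconv : Convex ℝ (valueRange G c) := by
    rintro _ ⟨x, hx, rfl⟩ _ ⟨y, hy, rfl⟩ r s hr hs hrs
    refine ⟨_, hG hx hy hr hs hrs, ?_⟩
    simp [dotProduct_add, dotProduct_smul]
  exact hconv.ordConnected.out h.1.1 h.2.1

/-- The sets in the list have nondegenerate ranges under `c` that subdivide the interval from
`a` to `b` in this order. -/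
def IsWalk (c : ι → ℝ) : ℝ → ℝ → List (Set (ι → ℝ)) → Prop
  | a, b, [] => a = b
  | a, b, G :: L => ∃ m, a < m ∧ HasRange c G a m ∧ IsWalk c m b L

theorem IsWalk.le {L : List (Set (ι → ℝ))} (h : IsWalk c a b L) : a ≤ b := by
  induction L generalizing a with
  | nil => exact h.le
  | cons G L ih =>
    obtain ⟨m, ham, -, h'⟩ := h
    exact ham.le.trans (ih h')

theorem IsWalk.exists_hasRange {L : List (Set (ι → ℝ))} (h : IsWalk c a b L) (hG : G ∈ L) :
    ∃ p q, a ≤ p ∧ p < q ∧ q ≤ b ∧ HasRange c G p q := by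
  induction L generalizing a with
  | nil => simp at hG
  | cons H L ih =>
    obtain ⟨m, ham, hH, h'⟩ := h
    rcases List.mem_cons.1 hG with rfl | hG
    · exact ⟨a, m, le_rfl, ham, h'.le, hH⟩
    · obtain ⟨p, q, hp, hpq, hq, hr⟩ := ih h' hG
      exact ⟨p, q, ham.le.trans hp, hpq, hq, hr⟩

theorem IsWalk.head {L : List (Set (ι → ℝ))} (h : IsWalk c a b L) (hL : L ≠ []) :
    ∃ m, HasRange c (L.head hL) a m := by
  cases L with
  | nil => exact absurd rfl hL
  | cons G L =>
    obtain ⟨m, -, hG, -⟩ := h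
    exact ⟨m, hG⟩

theorem IsWalk.getLast {L : List (Set (ι → ℝ))} (h : IsWalk c a b L) (hL : L ≠ []) :
    ∃ m, HasRange c (L.getLast hL) m b := by
  induction L generalizing a with
  | nil => exact absurd rfl hL
  | cons G L ih =>
    obtain ⟨m, -, hG, h'⟩ := h
    cases L with
    | nil =>
      obtain rfl : m = b := h'
      exact ⟨a, hG⟩
    | cons H L => exact ih h' (by simp)

/-- The compatibility condition between consecutive members of a cellular string. -/
abbrev Consecutive (c : ι → ℝ) (G H : Set (ι → ℝ)) : Prop :=
  maxFace G c = G ∩ H ∧ G ∩ H = minFace H c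

theorem isWalk_of_isChain {L : List (Set (ι → ℝ))} (hL : L ≠ [])
    (hR : ∀ G ∈ L, ∃ p q, p < q ∧ HasRange c G p q) (hch : L.IsChain (Consecutive c))
    (ha : ∃ m, HasRange c (L.head hL) a m) (hb : ∃ m, HasRange c (L.getLast hL) m b) :
    IsWalk c a b L := by
  induction L generalizing a with
  | nil => exact absurd rfl hL
  | cons G L ih =>
    obtain ⟨p, q, hpq, hG⟩ := hR G (by simp)
    obtain ⟨m, hG'⟩ := ha
    obtain rfl : p = a := hG.1.unique hG'.1
    refine ⟨q, hpq, hG, ?_⟩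
    cases L with
    | nil =>
      obtain ⟨m, hm⟩ := hb
      exact hG.2.unique hm.2
    | cons H L =>
      rw [List.isChain_cons_cons] at hch
      refine ih (by simp) (fun K hK => hR K (List.mem_cons_of_mem _ hK)) hch.2 ?_ hb
      obtain ⟨p', q', -, hH⟩ := hR H (by simp)
      obtain ⟨x, hx⟩ := hG.exists_maxFace
      have h1 := (hG.mem_maxFace.1 hx).2
      rw [hch.1.1, hch.1.2, hH.mem_minFace] at hx
      exact ⟨q', by rw [← h1, hx.2]; exact hH⟩

theorem IsCellularString.isWalk {F : List (Set (ι → ℝ))} (hP : IsCompact P)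
    (h : HasRange c P a b) (hF : IsCellularString P c F) : IsWalk c a b F := by
  have h0 : P.Nonempty := by
    obtain ⟨x, hx⟩ := h.exists_minFace
    exact ⟨x, hx.1⟩
  have hR : ∀ G ∈ F, ∃ p q, p < q ∧ HasRange c G p q := by
    intro G hG
    obtain ⟨p, q, hpq⟩ := MonotonePaths.exists_hasRange c ((hF.isFace G hG).isCompact hP)
      ((hF.isFace G hG).nonempty hP h0)
    exact ⟨p, q, hpq.notConstantOn_iff.1 (hF.notConstant G hG), hpq⟩
  refine isWalk_of_isChain hF.ne_nil hR hF.chain ?_ ?_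
  · obtain ⟨p, q, -, hpq⟩ := hR _ (List.head_mem hF.ne_nil)
    obtain ⟨x, hx⟩ := hpq.exists_minFace
    have h1 := (h.mem_minFace.1 (hF.first hx)).2
    have h2 := (hpq.mem_minFace.1 hx).2
    exact ⟨q, by rw [← h1, h2]; exact hpq⟩
  · obtain ⟨p, q, -, hpq⟩ := hR _ (List.getLast_mem hF.ne_nil)
    obtain ⟨x, hx⟩ := hpq.exists_maxFace
    have h1 := (h.mem_maxFace.1 (hF.last hx)).2
    have h2 := (hpq.mem_maxFace.1 hx).2
    exact ⟨p, by rw [← h1, h2]; exact hpq⟩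

/-- A list of faces of `P` with the compatibility condition and with the ranges of a subset `G`
that contains them is a cellular string on `G`. -/
theorem IsWalk.isCellularString {F : List (Set (ι → ℝ))} (hP : IsCompact P) (h0 : P.Nonempty)
    (hG : HasRange c G a b) (hab : a < b) (hGP : G ⊆ P) (hF : IsWalk c a b F)
    (hface : ∀ C ∈ F, IsFace P C) (hsub : ∀ C ∈ F, C ⊆ G) (hch : F.IsChain (Consecutive c)) :
    IsCellularString G c F := by
  have hne : F ≠ [] := by
    rintro rfl
    exact hab.ne hF
  refine ⟨hne, fun C hC => isFace_of_subset hP h0 (hface C hC) (hsub C hC) hGP,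
    fun C hC => ?_, fun x hx => ?_, fun x hx => ?_, hch⟩
  · obtain ⟨p, q, -, hpq, -, hr⟩ := hF.exists_hasRange hC
    exact hr.notConstantOn_iff.2 hpq
  · obtain ⟨m, hm⟩ := hF.head hne
    rw [hm.mem_minFace] at hx
    exact hG.mem_minFace.2 ⟨hsub _ (List.head_mem hne) hx.1, hx.2⟩
  · obtain ⟨m, hm⟩ := hF.getLast hne
    rw [hm.mem_maxFace] at hx
    exact hG.mem_maxFace.2 ⟨hsub _ (List.getLast_mem hne) hx.1, hx.2⟩

/-! ### Refinement is inclusion of unions -/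

/-- If every member of `F` lies in `G` or in a member of `L`, the ranges force the members in `G` to
come first and to fill the range of `G`. -/
theorem IsWalk.exists_split {G : Set (ι → ℝ)} {L F : List (Set (ι → ℝ))} {a₀ m : ℝ}
    (hG : HasRange c G a₀ m) (hL : IsWalk c m b L) (hF : IsWalk c a b F) (ham : a ≤ m)
    (hsub : ∀ C ∈ F, ∃ D ∈ G :: L, C ⊆ D) :
    ∃ F₁ F₂, F = F₁ ++ F₂ ∧ IsWalk c a m F₁ ∧ IsWalk c m b F₂ ∧ (∀ C ∈ F₁, C ⊆ G) ∧
      ∀ C ∈ F₂, ∃ D ∈ L, C ⊆ D := by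
  induction F generalizing a with
  | nil =>
    obtain rfl : a = b := hF
    obtain rfl : a = m := le_antisymm ham hL.le
    exact ⟨[], [], rfl, rfl, rfl, by simp, by simp⟩
  | cons C F ih =>
    rcases ham.eq_or_lt with rfl | ham
    · refine ⟨[], C :: F, rfl, rfl, hF, by simp, fun D hD => ?_⟩
      obtain ⟨K, hK, hDK⟩ := hsub D hD
      rcases List.mem_cons.1 hK with rfl | hK
      · obtain ⟨p, q, hp, hpq, -, hr⟩ := hF.exists_hasRange hD
        obtain ⟨x, hx⟩ := hr.exists_maxFace
        rw [hr.mem_maxFace] at hx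
        have := hG.ge (hDK hx.1)
        linarith [hx.2]
      · exact ⟨K, hK, hDK⟩
    · obtain ⟨k, hak, hC, hF'⟩ := hF
      have hCG : C ⊆ G := by
        obtain ⟨K, hK, hCK⟩ := hsub C (by simp)
        rcases List.mem_cons.1 hK with rfl | hK
        · exact hCK
        · obtain ⟨p, q, hp, -, -, hr⟩ := hL.exists_hasRange hK
          obtain ⟨x, hx⟩ := hC.exists_minFace
          rw [hC.mem_minFace] at hx
          have := hr.le (hCK hx.1)
          linarith [hx.2]
      have hkm : k ≤ m := by
        obtain ⟨x, hx⟩ := hC.exists_maxFace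
        rw [hC.mem_maxFace] at hx
        exact hx.2 ▸ hG.ge (hCG hx.1)
      obtain ⟨F₁, F₂, rfl, h1, h2, h3, h4⟩ :=
        ih hF' hkm fun D hD => hsub D (List.mem_cons_of_mem _ hD)
      refine ⟨C :: F₁, F₂, rfl, ⟨k, hak, hC, h1⟩, h2, ?_, h4⟩
      simpa using ⟨hCG, h3⟩

theorem IsWalk.refines {F G : List (Set (ι → ℝ))} (hP : IsCompact P) (h0 : P.Nonempty)
    (hF : IsWalk c a b F) (hG : IsWalk c a b G) (hface : ∀ C ∈ F, IsFace P C)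
    (hGP : ∀ D ∈ G, D ⊆ P) (hch : F.IsChain (Consecutive c))
    (hsub : ∀ C ∈ F, ∃ D ∈ G, C ⊆ D) : Refines c F G := by
  induction G generalizing a F with
  | nil =>
    obtain rfl : F = [] := by
      cases F with
      | nil => rfl
      | cons C F => simpa using hsub C (by simp)
    exact ⟨[], List.Forall₂.nil, rfl⟩
  | cons D G ih =>
    obtain ⟨m, ham, hD, hG'⟩ := hG
    obtain ⟨F₁, F₂, rfl, h1, h2, h3, h4⟩ := IsWalk.exists_split hD hG' hF ham.le hsub
    obtain ⟨L, hL, rfl⟩ := ih h2 hG' (fun C hC => hface C (by simp [hC]))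
      (fun K hK => hGP K (by simp [hK])) hch.right_of_append h4
    refine ⟨F₁ :: L, List.Forall₂.cons ?_ hL, rfl⟩
    exact h1.isCellularString hP h0 hD ham (hGP D (by simp)) (fun C hC => hface C (by simp [hC]))
      h3 hch.left_of_append

theorem IsWalk.eq_of_subset {F G : List (Set (ι → ℝ))} (hF : IsWalk c a b F)
    (hG : IsWalk c a b G) (hFG : ∀ C ∈ F, ∃ D ∈ G, C ⊆ D) (hGF : ∀ D ∈ G, ∃ C ∈ F, D ⊆ C) :
    F = G := by
  have head_sub : ∀ {a m n : ℝ} {C D : Set (ι → ℝ)} {G : List (Set (ι → ℝ))}, a < n →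
      HasRange c C a m → IsWalk c n b G → (∃ K ∈ D :: G, C ⊆ K) → C ⊆ D := by
    rintro a m n C D G han hC hG ⟨K, hK, hCK⟩
    rcases List.mem_cons.1 hK with rfl | hK
    · exact hCK
    · obtain ⟨p, q, hp, -, -, hr⟩ := hG.exists_hasRange hK
      obtain ⟨x, hx⟩ := hC.exists_minFace
      rw [hC.mem_minFace] at hx
      have := hr.le (hCK hx.1)
      linarith [hx.2]
  have tail_sub : ∀ {a m : ℝ} {D : Set (ι → ℝ)} {F G : List (Set (ι → ℝ))},
      HasRange c D a m → IsWalk c m b F → (∀ C ∈ F, ∃ K ∈ D :: G, C ⊆ K) →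
      ∀ C ∈ F, ∃ K ∈ G, C ⊆ K := by
    intro a m D F G hD hF h C hC
    obtain ⟨K, hK, hCK⟩ := h C hC
    rcases List.mem_cons.1 hK with rfl | hK
    · obtain ⟨p, q, hp, hpq, -, hr⟩ := hF.exists_hasRange hC
      obtain ⟨x, hx⟩ := hr.exists_maxFace
      rw [hr.mem_maxFace] at hx
      have := hD.ge (hCK hx.1)
      linarith [hx.2]
    · exact ⟨K, hK, hCK⟩
  induction F generalizing a G with
  | nil =>
    cases G with
    | nil => rfl
    | cons D G => simpa using hGF D (by simp)
  | cons C F ih =>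
    cases G with
    | nil => simpa using hFG C (by simp)
    | cons D G =>
      obtain ⟨m, ham, hC, hF'⟩ := hF
      obtain ⟨n, han, hD, hG'⟩ := hG
      obtain rfl : C = D := Set.Subset.antisymm (head_sub han hC hG' (hFG C (by simp)))
        (head_sub ham hD hF' (hGF D (by simp)))
      obtain rfl : m = n := hC.2.unique hD.2
      rw [ih hF' hG' (tail_sub hC hF' fun K hK => hFG K (by simp [hK]))
        (tail_sub hC hG' fun K hK => hGF K (by simp [hK]))]

theorem Refines.exists_mem {F G : List (Set (ι → ℝ))} (h : Refines c F G) {C : Set (ι → ℝ)}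
    (hC : C ∈ F) : ∃ D ∈ G, C ⊆ D := by
  obtain ⟨L, hL, rfl⟩ := h
  obtain ⟨S, hS, hCS⟩ := List.mem_flatten.1 hC
  clear hC
  induction hL with
  | nil => simp at hS
  | @cons D T G L hDT hGL ih =>
    rcases List.mem_cons.1 hS with rfl | hS
    · exact ⟨D, by simp, (hDT.isFace C hCS).subset⟩
    · obtain ⟨K, hK, hCK⟩ := ih hS
      exact ⟨K, by simp [hK], hCK⟩

end Faces

/-! ### Strings of faces `P^(w + t c)` -/

section Slopes

variable {ι : Type*} [Fintype ι] {P C G : Set (ι → ℝ)} {c w u : ι → ℝ} {a b : ℝ}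

/-- Every member of `F` is of the form `P^(w + t c)` for some real number `t`. -/
def HasSlopes (P : Set (ι → ℝ)) (c w : ι → ℝ) (F : List (Set (ι → ℝ))) : Prop :=
  ∀ G ∈ F, ∃ t : ℝ, G = maxFace P (w + t • c)

/-- In its fibre under `c`, a point of `P^(w + t c)` maximizes `w`. -/
theorem dotProduct_le_of_mem_maxFace_add {t : ℝ} {x y : ι → ℝ} (hx : x ∈ P)
    (hy : y ∈ maxFace P (w + t • c)) (hxy : c ⬝ᵥ x = c ⬝ᵥ y) : w ⬝ᵥ x ≤ w ⬝ᵥ y := by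
  have := hy.2 x hx
  simp only [add_dotProduct, smul_dotProduct, hxy] at this
  linarith

theorem mem_maxFace_add_of_le {t : ℝ} {x y : ι → ℝ} (hx : x ∈ P)
    (hy : y ∈ maxFace P (w + t • c)) (hxy : c ⬝ᵥ x = c ⬝ᵥ y) (hw : w ⬝ᵥ y ≤ w ⬝ᵥ x) :
    x ∈ maxFace P (w + t • c) := by
  refine ⟨hx, fun z hz => (hy.2 z hz).trans ?_⟩
  simp only [add_dotProduct, smul_dotProduct, hxy]
  linarith

/-- Consecutive members meet as required: a maximal point `x` of one member and a minimal point `y`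
of the next have the same value under `c`, so each is at least as good as the other for `w`, and
both lie in both members. -/
theorem IsWalk.isChain_consecutive {F : List (Set (ι → ℝ))} (hF : IsWalk c a b F)
    (hw : HasSlopes P c w F) : F.IsChain (Consecutive c) := by
  induction F generalizing a with
  | nil => exact List.isChain_nil
  | cons G F ih =>
    obtain ⟨m, ham, hG, hF'⟩ := hF
    have ih' := ih hF' fun K hK => hw K (List.mem_cons_of_mem _ hK)
    cases F with
    | nil => exact List.isChain_singleton _
    | cons H F =>
      obtain ⟨n, hmn, hH, -⟩ := hF'
      obtain ⟨t, rfl⟩ := hw G (by simp)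
      obtain ⟨t', rfl⟩ := hw H (by simp)
      have key : ∀ x ∈ maxFace (maxFace P (w + t • c)) c,
          ∀ y ∈ minFace (maxFace P (w + t' • c)) c,
            x ∈ maxFace P (w + t' • c) ∧ y ∈ maxFace P (w + t • c) := by
        intro x hx y hy
        rw [hG.mem_maxFace] at hx
        rw [hH.mem_minFace] at hy
        have hxy : c ⬝ᵥ x = c ⬝ᵥ y := hx.2.trans hy.2.symm
        have h1 := dotProduct_le_of_mem_maxFace_add hx.1.1 hy.1 hxy
        have h2 := dotProduct_le_of_mem_maxFace_add hy.1.1 hx.1 hxy.symm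
        exact ⟨mem_maxFace_add_of_le hx.1.1 hy.1 hxy h2,
          mem_maxFace_add_of_le hy.1.1 hx.1 hxy.symm h1⟩
      obtain ⟨x₀, hx₀⟩ := hG.exists_maxFace
      obtain ⟨y₀, hy₀⟩ := hH.exists_minFace
      refine List.isChain_cons_cons.2 ⟨⟨?_, ?_⟩, ih'⟩
      · ext x
        refine ⟨fun hx => ⟨hx.1, (key x hx y₀ hy₀).1⟩, fun hx => hG.mem_maxFace.2 ⟨hx.1, ?_⟩⟩
        exact le_antisymm (hG.ge hx.1) (hH.le hx.2)
      · ext y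
        refine ⟨fun hx => hH.mem_minFace.2 ⟨hx.2, ?_⟩, fun hy => ⟨(key x₀ hx₀ y hy).2, hy.1⟩⟩
        exact le_antisymm (hG.ge hx.1) (hH.le hx.2)

theorem IsWalk.exists_dotProduct_eq {F : List (Set (ι → ℝ))} (hF : IsWalk c a b F)
    (hconv : ∀ G ∈ F, Convex ℝ G) (hab : a < b) {s : ℝ} (hs : s ∈ Set.Icc a b) :
    ∃ G ∈ F, ∃ y ∈ G, c ⬝ᵥ y = s := by
  induction F generalizing a with
  | nil => exact absurd hF hab.ne
  | cons G F ih =>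
    obtain ⟨m, ham, hG, hF'⟩ := hF
    rcases le_or_gt s m with hsm | hsm
    · have : s ∈ valueRange G c := by
        rw [hG.valueRange_eq (hconv G (by simp))]
        exact ⟨hs.1, hsm⟩
      exact ⟨G, by simp, this⟩
    · obtain ⟨K, hK, h⟩ := ih hF' (fun K hK => hconv K (List.mem_cons_of_mem _ hK))
        (hsm.trans_le hs.2) ⟨hsm.le, hs.2⟩
      exact ⟨K, List.mem_cons_of_mem _ hK, h⟩

theorem HasSlopes.isFace {F : List (Set (ι → ℝ))} (hw : HasSlopes P c w F) :
    ∀ G ∈ F, IsFace P G := fun G hG => by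
  obtain ⟨t, h⟩ := hw G hG
  exact ⟨_, h⟩

/-! ### Coherence -/

theorem mem_maxFace_proj_image {v : Fin 2 → ℝ} {x : ι → ℝ} (hx : x ∈ P) :
    proj c w x ∈ maxFace (proj c w '' P) v ↔ x ∈ maxFace P (v 1 • w + v 0 • c) := by
  have h : ∀ y, v ⬝ᵥ proj c w y = (v 1 • w + v 0 • c) ⬝ᵥ y := by
    intro y
    simp [proj, dotProduct, Fin.sum_univ_two, add_mul, Finset.sum_add_distrib, Finset.mul_sum,
      mul_assoc, add_comm]
  simp only [maxFace, Set.mem_ofPred_eq, Set.forall_mem_image, h, Set.mem_image_of_mem _ hx, hx,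
    true_and]

/-- The points over the upper hull are exactly those in the members of the string. -/
theorem IsWalk.proj_mem_upperHull_iff {F : List (Set (ι → ℝ))} (hP : Convex ℝ P)
    (hr : HasRange c P a b) (hab : a < b) (hF : IsWalk c a b F) (hw : HasSlopes P c w F)
    {x : ι → ℝ} (hx : x ∈ P) :
    proj c w x ∈ upperHull (proj c w '' P) ↔ ∃ G ∈ F, x ∈ G := by
  constructor
  · rintro ⟨-, h⟩
    obtain ⟨G, hG, y, hy, hyx⟩ := hF.exists_dotProduct_eq
      (fun G hG => (hw.isFace G hG).convex hP) hab ⟨hr.le hx, hr.ge hx⟩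
    refine ⟨G, hG, ?_⟩
    obtain ⟨t, rfl⟩ := hw G hG
    refine mem_maxFace_add_of_le hx hy hyx.symm ?_
    by_contra! hlt
    refine h (w ⬝ᵥ y - w ⬝ᵥ x) (sub_pos.2 hlt) ⟨y, hy.1, ?_⟩
    ext i
    fin_cases i <;> simp [proj, hyx]
  · rintro ⟨G, hG, hxG⟩
    refine ⟨Set.mem_image_of_mem _ hx, fun ε hε => ?_⟩
    rintro ⟨y, hy, hyx⟩
    have h0 := congrFun hyx 0
    have h1 := congrFun hyx 1
    simp only [proj, Matrix.cons_val_zero, Matrix.cons_val_one, Matrix.cons_val_fin_one] at h0 h1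
    obtain ⟨t, rfl⟩ := hw G hG
    have := dotProduct_le_of_mem_maxFace_add hy hxG h0
    linarith

theorem IsCellularString.isCoherentFor {F : List (Set (ι → ℝ))} (hPc : IsCompact P)
    (hP : Convex ℝ P) (hr : HasRange c P a b) (hab : a < b) (hF : IsCellularString P c F)
    (hw : HasSlopes P c w F) : IsCoherentFor P c w F := by
  have hwalk := hF.isWalk hPc hr
  have hpre : ∀ v : Fin 2 → ℝ, P ∩ proj c w ⁻¹' maxFace (proj c w '' P) v =
      maxFace P (v 1 • w + v 0 • c) := by
    intro v
    ext x
    exact ⟨fun hx => (mem_maxFace_proj_image hx.1).1 hx.2,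
      fun hx => ⟨hx.1, (mem_maxFace_proj_image hx.1).2 hx⟩⟩
  refine ⟨hF, fun C => ⟨fun hC => ?_, ?_⟩⟩
  · obtain ⟨t, rfl⟩ := hw C hC
    have hv : (![t, 1] : Fin 2 → ℝ) 1 • w + (![t, 1] : Fin 2 → ℝ) 0 • c = w + t • c := by simp
    refine ⟨maxFace (proj c w '' P) ![t, 1], ⟨⟨_, rfl⟩, ?_, ?_⟩, ?_⟩
    · rintro _ hq
      obtain ⟨x, hx, rfl⟩ := hq.1
      rw [mem_maxFace_proj_image hx, hv] at hq
      exact (hwalk.proj_mem_upperHull_iff hP hr hab hw hx).2 ⟨_, hC, hq⟩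
    · obtain ⟨x, hx, y, hy, hxy⟩ := hF.notConstant _ hC
      refine ⟨proj c w x, (mem_maxFace_proj_image hx.1).2 (hv ▸ hx), proj c w y,
        (mem_maxFace_proj_image hy.1).2 (hv ▸ hy), fun h => hxy ?_⟩
      simpa [proj] using congrFun h 0
    · rw [hpre, hv]
  · rintro ⟨e, ⟨⟨v, rfl⟩, hup, hnt⟩, rfl⟩
    obtain ⟨p, hp, q, hq, hpq⟩ := hnt
    obtain ⟨x, hx, rfl⟩ := hp.1
    obtain ⟨y, hy, rfl⟩ := hq.1
    rw [hpre]
    have hxy : c ⬝ᵥ x ≠ c ⬝ᵥ y := by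
      intro h
      apply hpq
      have aux : ∀ {x y : ι → ℝ}, x ∈ P → y ∈ P → c ⬝ᵥ x = c ⬝ᵥ y →
          proj c w x ∈ upperHull (proj c w '' P) → w ⬝ᵥ y ≤ w ⬝ᵥ x := by
        intro x y hx hy h hu
        obtain ⟨G, hG, hxG⟩ := (hwalk.proj_mem_upperHull_iff hP hr hab hw hx).1 hu
        obtain ⟨t, rfl⟩ := hw G hG
        exact dotProduct_le_of_mem_maxFace_add hy hxG h.symm
      have h' := le_antisymm (aux hy hx h.symm (hup hq)) (aux hx hy h (hup hp))
      simp [proj, h, h']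
    rw [mem_maxFace_proj_image hx] at hp
    rw [mem_maxFace_proj_image hy] at hq
    obtain ⟨G, hG, hCG⟩ := exists_subset_of_subset_iUnion hF.isFace (convex_maxFace hP _)
      ⟨x, hp⟩ maxFace_subset fun z hz => (hwalk.proj_mem_upperHull_iff hP hr hab hw hz.1).1
        (hup ((mem_maxFace_proj_image hz.1).2 hz))
    -- It remains to show that the member containing the preimage is not larger than it.
    suffices h : G ⊆ maxFace P (v 1 • w + v 0 • c) by
      rw [hCG.antisymm h]
      exact hG
    obtain ⟨t, rfl⟩ := hw G hG
    have const : ∀ {d : ι → ℝ} {x y : ι → ℝ}, x ∈ maxFace P d → y ∈ maxFace P d →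
        d ⬝ᵥ x = d ⬝ᵥ y := fun hx hy => le_antisymm (hy.2 _ hx.1) (hx.2 _ hy.1)
    have h1 := const (hCG hp) (hCG hq)
    have h2 := const hp hq
    simp only [add_dotProduct, smul_dotProduct, smul_eq_mul] at h1 h2
    have hv : v 0 = v 1 * t := by
      have : (v 0 - v 1 * t) * (c ⬝ᵥ x - c ⬝ᵥ y) = 0 := by linear_combination h2 - v 1 * h1
      rcases mul_eq_zero.1 this with h | h
      · linarith
      · exact absurd (sub_eq_zero.1 h) hxy
    intro z hz
    refine ⟨hz.1, fun z' hz' => (hp.2 z' hz').trans_eq ?_⟩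
    have h3 := const (hCG hp) hz
    simp only [add_dotProduct, smul_dotProduct, smul_eq_mul] at h3 ⊢
    rw [hv]
    linear_combination v 1 * h3

/-! ### Sections inside the union of a string -/

/-- There is a section of `c` over the interval from `c x` to `c y`, with values in `S`, that
leads from `x` to `y`. -/
def Conn (c : ι → ℝ) (S : Set (ι → ℝ)) (x y : ι → ℝ) : Prop :=
  c ⬝ᵥ x ≤ c ⬝ᵥ y ∧ ∃ γ : ℝ → ι → ℝ, ContinuousOn γ (Set.Icc (c ⬝ᵥ x) (c ⬝ᵥ y)) ∧
    (∀ s ∈ Set.Icc (c ⬝ᵥ x) (c ⬝ᵥ y), γ s ∈ S ∧ c ⬝ᵥ γ s = s) ∧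
    γ (c ⬝ᵥ x) = x ∧ γ (c ⬝ᵥ y) = y

theorem Conn.mono {S T : Set (ι → ℝ)} {x y : ι → ℝ} (h : Conn c S x y) (hST : S ⊆ T) :
    Conn c T x y := by
  obtain ⟨hxy, γ, h1, h2, h3⟩ := h
  exact ⟨hxy, γ, h1, fun s hs => ⟨hST (h2 s hs).1, (h2 s hs).2⟩, h3⟩

theorem Conn.refl {S : Set (ι → ℝ)} {x : ι → ℝ} (hx : x ∈ S) : Conn c S x x := by
  refine ⟨le_rfl, fun _ => x, continuousOn_const, fun s hs => ⟨hx, ?_⟩, rfl, rfl⟩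
  exact le_antisymm hs.1 hs.2

theorem Conn.exists_through {S : Set (ι → ℝ)} {x y z : ι → ℝ} (h : Conn c S x y)
    (h' : Conn c S y z) : ∃ γ : ℝ → ι → ℝ, ContinuousOn γ (Set.Icc (c ⬝ᵥ x) (c ⬝ᵥ z)) ∧
      (∀ s ∈ Set.Icc (c ⬝ᵥ x) (c ⬝ᵥ z), γ s ∈ S ∧ c ⬝ᵥ γ s = s) ∧
      γ (c ⬝ᵥ x) = x ∧ γ (c ⬝ᵥ y) = y ∧ γ (c ⬝ᵥ z) = z := by
  obtain ⟨hxy, γ, h1, h2, h3, h4⟩ := h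
  obtain ⟨hyz, δ, k1, k2, k3, k4⟩ := h'
  have e1 : Set.EqOn (fun s => if s ≤ c ⬝ᵥ y then γ s else δ s) γ
      (Set.Icc (c ⬝ᵥ x) (c ⬝ᵥ y)) := fun s hs => if_pos hs.2
  have e2 : Set.EqOn (fun s => if s ≤ c ⬝ᵥ y then γ s else δ s) δ
      (Set.Icc (c ⬝ᵥ y) (c ⬝ᵥ z)) := by
    intro s hs
    rcases hs.1.eq_or_lt with rfl | hlt
    · simp [h4, k3]
    · exact if_neg hlt.not_ge
  have hU : Set.Icc (c ⬝ᵥ x) (c ⬝ᵥ z) =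
      Set.Icc (c ⬝ᵥ x) (c ⬝ᵥ y) ∪ Set.Icc (c ⬝ᵥ y) (c ⬝ᵥ z) :=
    (Set.Icc_union_Icc_eq_Icc hxy hyz).symm
  refine ⟨fun s => if s ≤ c ⬝ᵥ y then γ s else δ s, ?_, ?_, ?_, ?_, ?_⟩
  · rw [hU]
    exact (h1.congr e1).union_of_isClosed (k1.congr e2) isClosed_Icc isClosed_Icc
  · rw [hU]
    rintro s (hs | hs)
    · rw [e1 hs]
      exact h2 s hs
    · rw [e2 hs]
      exact k2 s hs
  · exact (e1 ⟨le_rfl, hxy⟩).trans h3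
  · exact (e1 ⟨hxy, le_rfl⟩).trans h4
  · exact (e2 ⟨hyz, le_rfl⟩).trans k4

theorem Conn.trans {S : Set (ι → ℝ)} {x y z : ι → ℝ} (h : Conn c S x y) (h' : Conn c S y z) :
    Conn c S x z := by
  obtain ⟨γ, h1, h2, h3, -, h4⟩ := h.exists_through h'
  exact ⟨h.1.trans h'.1, γ, h1, h2, h3, h4⟩

theorem Conn.of_lt {S : Set (ι → ℝ)} (hS : Convex ℝ S) {x y : ι → ℝ} (hx : x ∈ S) (hy : y ∈ S)
    (h : c ⬝ᵥ x < c ⬝ᵥ y) : Conn c S x y := by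
  have hd : 0 < c ⬝ᵥ y - c ⬝ᵥ x := sub_pos.2 h
  refine ⟨h.le, fun s => AffineMap.lineMap x y ((s - c ⬝ᵥ x) / (c ⬝ᵥ y - c ⬝ᵥ x)), ?_, ?_, ?_, ?_⟩
  · simp only [AffineMap.lineMap_apply_module]
    fun_prop
  · intro s hs
    refine ⟨hS.lineMap_mem hx hy ⟨div_nonneg (sub_nonneg.2 hs.1) hd.le, ?_⟩, ?_⟩
    · rw [div_le_one hd]
      linarith [hs.2]
    · simp only [AffineMap.lineMap_apply_module, dotProduct_add, dotProduct_smul, smul_eq_mul]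
      field_simp
      ring
  · simp
  · simp [div_self hd.ne']

theorem HasRange.exists_conn_maxFace (h : HasRange c G a b) (hG : Convex ℝ G) {x : ι → ℝ}
    (hx : x ∈ G) : ∃ y ∈ maxFace G c, Conn c G x y := by
  rcases (h.ge hx).eq_or_lt with hb | hb
  · exact ⟨x, h.mem_maxFace.2 ⟨hx, hb⟩, Conn.refl hx⟩
  · obtain ⟨y, hy⟩ := h.exists_maxFace
    exact ⟨y, hy, Conn.of_lt hG hx hy.1 (by rwa [(h.mem_maxFace.1 hy).2])⟩

theorem HasRange.exists_conn_minFace (h : HasRange c G a b) (hG : Convex ℝ G) {x : ι → ℝ}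
    (hx : x ∈ G) : ∃ y ∈ minFace G c, Conn c G y x := by
  rcases (h.le hx).eq_or_lt with ha | ha
  · exact ⟨x, h.mem_minFace.2 ⟨hx, ha.symm⟩, Conn.refl hx⟩
  · obtain ⟨y, hy⟩ := h.exists_minFace
    exact ⟨y, hy, Conn.of_lt hG hy.1 hx (by rwa [(h.mem_minFace.1 hy).2])⟩

theorem IsWalk.exists_conn_right {F : List (Set (ι → ℝ))} (hF : IsWalk c a b F)
    (hconv : ∀ G ∈ F, Convex ℝ G) (hch : F.IsChain (Consecutive c)) {x : ι → ℝ}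
    (hx : ∃ G ∈ F, x ∈ G) : ∃ y, c ⬝ᵥ y = b ∧ Conn c {z | ∃ G ∈ F, z ∈ G} x y := by
  induction F generalizing a x with
  | nil => simp at hx
  | cons G F ih =>
    obtain ⟨m, ham, hG, hF'⟩ := hF
    have ih' : ∀ {x : ι → ℝ}, (∃ H ∈ F, x ∈ H) →
        ∃ y, c ⬝ᵥ y = b ∧ Conn c {z | ∃ H ∈ G :: F, z ∈ H} x y := by
      intro x hx
      obtain ⟨y, hy, h⟩ := ih hF' (fun K hK => hconv K (List.mem_cons_of_mem _ hK)) hch.tail hx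
      exact ⟨y, hy, h.mono fun z ⟨K, hK, hz⟩ => ⟨K, List.mem_cons_of_mem _ hK, hz⟩⟩
    obtain ⟨K, hK, hxK⟩ := hx
    rcases List.mem_cons.1 hK with rfl | hK
    · obtain ⟨y, hy, hxy⟩ := hG.exists_conn_maxFace (hconv K (by simp)) hxK
      have hxy' := hxy.mono (T := {z | ∃ H ∈ K :: F, z ∈ H}) fun z hz => ⟨K, by simp, hz⟩
      cases F with
      | nil => exact ⟨y, (hG.mem_maxFace.1 hy).2.trans hF', hxy'⟩
      | cons H F =>
        have hyH : y ∈ H := by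
          rw [(List.isChain_cons_cons.1 hch).1.1] at hy
          exact hy.2
        obtain ⟨z, hz, hyz⟩ := ih' ⟨H, by simp, hyH⟩
        exact ⟨z, hz, hxy'.trans hyz⟩
    · exact ih' ⟨K, hK, hxK⟩

theorem IsWalk.exists_conn_left {F : List (Set (ι → ℝ))} (hF : IsWalk c a b F)
    (hconv : ∀ G ∈ F, Convex ℝ G) (hch : F.IsChain (Consecutive c)) {x : ι → ℝ}
    (hx : ∃ G ∈ F, x ∈ G) : ∃ y, (∀ G ∈ F.head?, y ∈ minFace G c) ∧ c ⬝ᵥ y = a ∧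
      Conn c {z | ∃ G ∈ F, z ∈ G} y x := by
  induction F generalizing a x with
  | nil => simp at hx
  | cons G F ih =>
    obtain ⟨m, ham, hG, hF'⟩ := hF
    have first : ∀ {x : ι → ℝ}, x ∈ G → ∃ y, (∀ H ∈ (G :: F).head?, y ∈ minFace H c) ∧
        c ⬝ᵥ y = a ∧ Conn c {z | ∃ H ∈ G :: F, z ∈ H} y x := by
      intro x hx
      obtain ⟨y, hy, hyx⟩ := hG.exists_conn_minFace (hconv G (by simp)) hx
      exact ⟨y, by simpa using hy, (hG.mem_minFace.1 hy).2, hyx.mono fun z hz => ⟨G, by simp, hz⟩⟩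
    obtain ⟨K, hK, hxK⟩ := hx
    rcases List.mem_cons.1 hK with rfl | hK
    · exact first hxK
    · obtain ⟨y, hyF, -, hyx⟩ := ih hF' (fun K hK => hconv K (List.mem_cons_of_mem _ hK)) hch.tail
        ⟨K, hK, hxK⟩
      have hyx' := hyx.mono (T := {z | ∃ H ∈ G :: F, z ∈ H})
        fun z ⟨K, hK, hz⟩ => ⟨K, List.mem_cons_of_mem _ hK, hz⟩
      have hyG : y ∈ G := by
        cases F with
        | nil => simp at hK
        | cons H F =>
          have hyH : y ∈ minFace H c := hyF H (by simp)
          rw [← (List.isChain_cons_cons.1 hch).1.2] at hyH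
          exact hyH.1
      obtain ⟨z, hzG, hz, hzy⟩ := first hyG
      exact ⟨z, hzG, hz, hzy.trans hyx'⟩

/-- The union of a cellular string contains a section through each of its points. -/
theorem IsCellularString.exists_isSection {F : List (Set (ι → ℝ))} (hPc : IsCompact P)
    (hP : Convex ℝ P) (hr : HasRange c P a b) (hF : IsCellularString P c F) {x : ι → ℝ}
    (hx : ∃ G ∈ F, x ∈ G) : ∃ γ, IsSection P c γ ∧
      (∀ s ∈ valueRange P c, ∃ G ∈ F, γ s ∈ G) ∧ γ (c ⬝ᵥ x) = x := by
  have hw := hF.isWalk hPc hr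
  have hconv : ∀ G ∈ F, Convex ℝ G := fun G hG => (hF.isFace G hG).convex hP
  obtain ⟨y, -, rfl, hyx⟩ := hw.exists_conn_left hconv hF.chain hx
  obtain ⟨z, rfl, hxz⟩ := hw.exists_conn_right hconv hF.chain hx
  have hS : {z | ∃ G ∈ F, z ∈ G} ⊆ P := fun z ⟨G, hG, hz⟩ => (hF.isFace G hG).subset hz
  obtain ⟨γ, h1, h2, -, h3, -⟩ := hyx.exists_through hxz
  rw [← hr.valueRange_eq hP] at h1 h2
  exact ⟨γ, ⟨h1, fun s hs => hS (h2 s hs).1, fun s hs => (h2 s hs).2⟩, fun s hs => (h2 s hs).1, h3⟩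

/-! ### Faces of the monotone path polytope -/

theorem dotProduct_setIntegral_Icc (w : ι → ℝ) {γ : ℝ → ι → ℝ}
    (hγ : ContinuousOn γ (Set.Icc a b)) :
    w ⬝ᵥ ∫ s in Set.Icc a b, γ s = ∫ s in Set.Icc a b, w ⬝ᵥ γ s :=
  ((LinearMap.toContinuousLinearMap (dotProductBilin ℝ ℝ w)).integral_comp_comm
    hγ.integrableOn_Icc).symm

theorem eqOn_of_setIntegral_le {g h : ℝ → ℝ} (hab : a < b) (hg : ContinuousOn g (Set.Icc a b))
    (hh : ContinuousOn h (Set.Icc a b)) (hle : ∀ s ∈ Set.Icc a b, g s ≤ h s)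
    (hint : ∫ s in Set.Icc a b, h s ≤ ∫ s in Set.Icc a b, g s) :
    ∀ s ∈ Set.Icc a b, h s = g s := by
  have hd : ContinuousOn (fun s => h s - g s) (Set.Icc a b) := hh.sub hg
  have hnn : 0 ≤ᵐ[volume.restrict (Set.Icc a b)] fun s => h s - g s :=
    (ae_restrict_mem measurableSet_Icc).mono fun s hs => sub_nonneg.2 (hle s hs)
  have hz : ∫ s in Set.Icc a b, h s - g s = 0 := by
    refine le_antisymm ?_ (integral_nonneg_of_ae hnn)
    rw [integral_sub hh.integrableOn_Icc hg.integrableOn_Icc]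
    linarith
  have hae := (setIntegral_eq_zero_iff_of_nonneg_ae hnn hd.integrableOn_Icc).1 hz
  intro s hs
  exact sub_eq_zero.1 (Measure.eqOn_Icc_of_ae_eq volume hab.ne hae hd continuousOn_const hs)

/-- A section gives a point of the face of the monotone path polytope in direction `w` exactly if
it stays in the members of the string for `w`: these sections maximize `w` pointwise. -/
theorem IsCellularString.mem_maxFace_monotonePathPolytope_iff {F : List (Set (ι → ℝ))}
    (hPc : IsCompact P) (hP : Convex ℝ P) (hr : HasRange c P a b) (hab : a < b)
    (hF : IsCellularString P c F) (hw : HasSlopes P c w F) {γ : ℝ → ι → ℝ}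
    (hγ : IsSection P c γ) :
    (2 : ℝ) • ∫ s in valueRange P c, γ s ∈ maxFace (monotonePathPolytope P c) w ↔
      ∀ s ∈ valueRange P c, ∃ G ∈ F, γ s ∈ G := by
  have hle : ∀ {γ δ : ℝ → ι → ℝ}, IsSection P c γ → IsSection P c δ →
      (∀ s ∈ valueRange P c, ∃ G ∈ F, δ s ∈ G) →
      ∀ s ∈ valueRange P c, w ⬝ᵥ γ s ≤ w ⬝ᵥ δ s := by
    intro γ δ hγ hδ hδF s hs
    obtain ⟨G, hG, hδG⟩ := hδF s hs
    obtain ⟨t, rfl⟩ := hw G hG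
    exact dotProduct_le_of_mem_maxFace_add (hγ.mem s hs) hδG
      ((hγ.value s hs).trans (hδ.value s hs).symm)
  have hI := hr.valueRange_eq hP
  have hcont : ∀ {γ : ℝ → ι → ℝ}, IsSection P c γ →
      ContinuousOn (fun s => w ⬝ᵥ γ s) (Set.Icc a b) := fun hγ =>
    (continuous_dotProduct_left w).comp_continuousOn (hI ▸ hγ.continuousOn)
  have hdot : ∀ {γ : ℝ → ι → ℝ}, IsSection P c γ →
      w ⬝ᵥ ((2 : ℝ) • ∫ s in valueRange P c, γ s) = 2 * ∫ s in Set.Icc a b, w ⬝ᵥ γ s := by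
    intro γ hγ
    rw [dotProduct_smul, smul_eq_mul, hI, dotProduct_setIntegral_Icc w (hI ▸ hγ.continuousOn)]
  constructor
  · intro hmem
    obtain ⟨x, hx⟩ : (F.head hF.ne_nil).Nonempty := by
      obtain ⟨x, hx, -⟩ := hF.notConstant _ (List.head_mem hF.ne_nil)
      exact ⟨x, hx⟩
    obtain ⟨δ, hδ, hδF, -⟩ := hF.exists_isSection hPc hP hr ⟨_, List.head_mem hF.ne_nil, hx⟩
    have h := hmem.2 _ ⟨δ, hδ, rfl⟩
    rw [hdot hγ, hdot hδ] at h
    have heq := eqOn_of_setIntegral_le hab (hcont hγ) (hcont hδ) (hI ▸ hle hγ hδ hδF)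
      (by linarith)
    intro s hs
    obtain ⟨G, hG, hδG⟩ := hδF s hs
    refine ⟨G, hG, ?_⟩
    obtain ⟨t, rfl⟩ := hw G hG
    exact mem_maxFace_add_of_le (hγ.mem s hs) hδG
      ((hγ.value s hs).trans (hδ.value s hs).symm) (heq s (hI ▸ hs)).le
  · intro hγF
    refine ⟨⟨γ, hγ, rfl⟩, ?_⟩
    rintro _ ⟨δ, hδ, rfl⟩
    rw [hdot hγ, hdot hδ]
    exact mul_le_mul_of_nonneg_left (setIntegral_mono_on (hcont hδ).integrableOn_Icc
      (hcont hγ).integrableOn_Icc measurableSet_Icc (hI ▸ hle hδ hγ hγF)) zero_le_two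

/-- If every cellular string consists of faces `P^(w + t c)` for one `w`, and every `w` arises in
this way, then the Baues poset is the face poset of the monotone path polytope. -/
theorem nonempty_baues_orderIso (hPc : IsCompact P) (hP : Convex ℝ P) (hr : HasRange c P a b)
    (hab : a < b) (hslopes : ∀ F, IsCellularString P c F → ∃ w, HasSlopes P c w F)
    (hstring : ∀ w, ∃ F, IsCellularString P c F ∧ HasSlopes P c w F) :
    Nonempty (Baues P c ≃o Faces (monotonePathPolytope P c)) := by
  have h0 : P.Nonempty := by
    obtain ⟨x, hx⟩ := hr.exists_minFace
    exact ⟨x, hx.1⟩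
  choose dir hdir using hslopes
  let Φ : Baues P c → Faces (monotonePathPolytope P c) := fun F =>
    ⟨maxFace (monotonePathPolytope P c) (dir F.1 F.2), _, rfl⟩
  have hΦ : ∀ F : Baues P c, ∀ x, x ∈ (Φ F).1 ↔ ∃ γ, IsSection P c γ ∧
      (∀ s ∈ valueRange P c, ∃ G ∈ F.1, γ s ∈ G) ∧ x = (2 : ℝ) • ∫ s in valueRange P c, γ s := by
    intro F x
    constructor
    · intro hx
      obtain ⟨γ, hγ, rfl⟩ := hx.1
      exact ⟨γ, hγ, (F.2.mem_maxFace_monotonePathPolytope_iff hPc hP hr hab (hdir _ F.2) hγ).1 hx,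
        rfl⟩
    · rintro ⟨γ, hγ, hγF, rfl⟩
      exact (F.2.mem_maxFace_monotonePathPolytope_iff hPc hP hr hab (hdir _ F.2) hγ).2 hγF
  have hsub : ∀ F G : Baues P c, Φ F ≤ Φ G → ∀ C ∈ F.1, ∃ D ∈ G.1, C ⊆ D := by
    intro F G h C hC
    have hCf := F.2.isFace C hC
    refine exists_subset_of_subset_iUnion G.2.isFace (hCf.convex hP) (hCf.nonempty hPc h0)
      hCf.subset fun x hx => ?_
    obtain ⟨γ, hγ, hγF, hγx⟩ := F.2.exists_isSection hPc hP hr ⟨C, hC, hx⟩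
    have hmem : _ ∈ (Φ G).1 := h ((hΦ F _).2 ⟨γ, hγ, hγF, rfl⟩)
    have := (G.2.mem_maxFace_monotonePathPolytope_iff hPc hP hr hab (hdir _ G.2) hγ).1 hmem
      (c ⬝ᵥ x) ⟨x, hCf.subset hx, rfl⟩
    rwa [hγx] at this
  refine ⟨⟨Equiv.ofBijective Φ ⟨fun F G h => ?_, ?_⟩, ?_⟩⟩
  · exact Subtype.ext ((F.2.isWalk hPc hr).eq_of_subset (G.2.isWalk hPc hr) (hsub F G h.le)
      (hsub G F h.ge))
  · rintro ⟨_, w, rfl⟩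
    obtain ⟨F, hF, hw⟩ := hstring w
    refine ⟨⟨F, hF⟩, Subtype.ext (Set.ext fun x => (hΦ ⟨F, hF⟩ x).trans ⟨?_, ?_⟩)⟩
    · rintro ⟨γ, hγ, hγF, rfl⟩
      exact (hF.mem_maxFace_monotonePathPolytope_iff hPc hP hr hab hw hγ).2 hγF
    · intro hx
      obtain ⟨γ, hγ, rfl⟩ := hx.1
      exact ⟨γ, hγ, (hF.mem_maxFace_monotonePathPolytope_iff hPc hP hr hab hw hγ).1 hx, rfl⟩
  · intro F G
    constructor
    · intro h
      exact (F.2.isWalk hPc hr).refines hPc h0 (G.2.isWalk hPc hr) F.2.isFace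
        (fun D hD => (G.2.isFace D hD).subset) F.2.chain (hsub F G h)
    · intro h x hx
      obtain ⟨γ, hγ, hγF, rfl⟩ := (hΦ F x).1 hx
      refine (hΦ G _).2 ⟨γ, hγ, fun s hs => ?_, rfl⟩
      obtain ⟨C, hC, hs⟩ := hγF s hs
      obtain ⟨D, hD, hCD⟩ := Refines.exists_mem h hC
      exact ⟨D, hD, hCD hs⟩

end Slopes

section PolymatroidFaces

variable {E : Type*} {f : Finset E → ℝ}

/-! ### The polytope of a polymatroid -/

theorem IsPolymatroid.le_of_subset [DecidableEq E] (hf : IsPolymatroid f) {A B : Finset E}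
    (h : A ⊆ B) :
    f A ≤ f B := by
  simpa [Finset.union_eq_right.2 h] using hf.mono A B

theorem mem_polytope_of_le {x y : E → ℝ} (hx : x ∈ polytope f) (h0 : ∀ e, 0 ≤ y e)
    (h : ∀ e, y e ≤ x e) : y ∈ polytope f :=
  ⟨h0, fun A => (Finset.sum_le_sum fun e _ => h e).trans (hx.2 A)⟩

theorem IsPolymatroid.zero_mem [DecidableEq E] (hf : IsPolymatroid f) : (0 : E → ℝ) ∈ polytope f :=
  ⟨fun _ => le_rfl, fun A => by simpa [hf.empty] using hf.le_of_subset (Finset.empty_subset A)⟩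

theorem isClosed_polytope (f : Finset E → ℝ) : IsClosed (polytope f) := by
  have : polytope f = (⋂ e, {x | 0 ≤ x e}) ∩ ⋂ A : Finset E, {x | ∑ e ∈ A, x e ≤ f A} := by
    ext
    simp [polytope]
  rw [this]
  exact (isClosed_iInter fun e => isClosed_le continuous_const (continuous_apply e)).inter
    (isClosed_iInter fun A =>
      isClosed_le (continuous_finsetSum A fun e _ => continuous_apply e) continuous_const)

theorem isCompact_polytope (f : Finset E → ℝ) : IsCompact (polytope f) := by
  refine isCompact_Icc.of_isClosed_subset (isClosed_polytope f)
    (fun x hx => ⟨fun e => hx.1 e, fun e => ?_⟩ : _ ⊆ Set.Icc (0 : E → ℝ) fun e => f {e})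
  simpa using hx.2 {e}

theorem convex_polytope (f : Finset E → ℝ) : Convex ℝ (polytope f) := by
  intro x hx y hy r s hr hs hrs
  refine ⟨fun e => add_nonneg (mul_nonneg hr (hx.1 e)) (mul_nonneg hs (hy.1 e)), fun A => ?_⟩
  simp only [Pi.add_apply, Pi.smul_apply, smul_eq_mul, Finset.sum_add_distrib, ← Finset.mul_sum]
  calc _ ≤ r * f A + s * f A := add_le_add (mul_le_mul_of_nonneg_left (hx.2 A) hr)
        (mul_le_mul_of_nonneg_left (hy.2 A) hs)
    _ = f A := by rw [← add_mul, hrs, one_mul]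

/-- The point that agrees with `x` on `S` and vanishes elsewhere. -/
def restr [DecidableEq E] (S : Finset E) (x : E → ℝ) : E → ℝ := fun e => if e ∈ S then x e else 0

theorem restr_apply_of_mem [DecidableEq E] {S : Finset E} {e : E} (h : e ∈ S) (x : E → ℝ) :
    restr S x e = x e := if_pos h

theorem restr_apply_of_notMem [DecidableEq E] {S : Finset E} {e : E} (h : e ∉ S) (x : E → ℝ) :
    restr S x e = 0 := if_neg h

theorem restr_le [DecidableEq E] {x : E → ℝ} (hx : x ∈ polytope f) (S : Finset E) (e : E) :
    restr S x e ≤ x e := by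
  unfold restr
  split_ifs
  exacts [le_rfl, hx.1 e]

theorem restr_mem [DecidableEq E] {x : E → ℝ} (hx : x ∈ polytope f) (S : Finset E) :
    restr S x ∈ polytope f := by
  refine mem_polytope_of_le hx (fun e => ?_) (restr_le hx S)
  unfold restr
  split_ifs
  exacts [hx.1 e, le_rfl]

/-- The sets at which a point attains its bound are closed under unions, by submodularity. -/
theorem IsPolymatroid.sum_union_eq [DecidableEq E] (hf : IsPolymatroid f) {x : E → ℝ}
    (hx : x ∈ polytope f)
    {A B : Finset E} (hA : ∑ e ∈ A, x e = f A) (hB : ∑ e ∈ B, x e = f B) :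
    ∑ e ∈ A ∪ B, x e = f (A ∪ B) := by
  have h1 := Finset.sum_union_inter (s₁ := A) (s₂ := B) (f := x)
  have h2 := hf.submodular A B
  have h3 := hx.2 (A ∪ B)
  have h4 := hx.2 (A ∩ B)
  linarith

variable [Fintype E]

theorem one_dotProduct_eq_sum {x : E → ℝ} {A : Finset E} (h : ∀ e ∉ A, x e = 0) :
    (1 : E → ℝ) ⬝ᵥ x = ∑ e ∈ A, x e := by
  rw [one_dotProduct]
  exact (Finset.sum_subset (Finset.subset_univ A) fun e _ he => h e he).symm

theorem sum_le_one_dotProduct {x : E → ℝ} (hx : x ∈ polytope f) (A : Finset E) :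
    ∑ e ∈ A, x e ≤ (1 : E → ℝ) ⬝ᵥ x := by
  rw [one_dotProduct]
  exact Finset.sum_le_sum_of_subset_of_nonneg (Finset.subset_univ A) fun e _ _ => hx.1 e

open Classical in
/-- The support of a set of points: the coordinates that do not vanish on all of it. -/
noncomputable def support (F : Set (E → ℝ)) : Finset E := {e | ∃ x ∈ F, x e ≠ 0}

theorem eq_zero_of_notMem_support {F : Set (E → ℝ)} {y : E → ℝ} (hy : y ∈ F) {e : E}
    (he : e ∉ support F) : y e = 0 := by
  by_contra h
  exact he (by simpa [support] using ⟨y, hy, h⟩)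

variable [DecidableEq E]

/-- Every point of the polytope supported on `T` lies below a point supported on `T` that attains
the bound for `T`: a maximal point above it has tight sets around every element of `T`. -/
theorem IsPolymatroid.exists_le_sum_eq (hf : IsPolymatroid f) {x : E → ℝ} (hx : x ∈ polytope f)
    {T : Finset E} (hxT : ∀ e ∉ T, x e = 0) :
    ∃ y ∈ polytope f, (∀ e, x e ≤ y e) ∧ (∀ e ∉ T, y e = 0) ∧ ∑ e ∈ T, y e = f T := by
  have hK : IsCompact (polytope f ∩
      ((⋂ e, {y | x e ≤ y e}) ∩ ⋂ e ∈ (T : Set E)ᶜ, {y | y e = 0})) :=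
    (isCompact_polytope f).inter_right <| (isClosed_iInter fun e =>
      isClosed_le continuous_const (continuous_apply e)).inter <|
      isClosed_biInter fun e _ => isClosed_eq (continuous_apply e) continuous_const
  obtain ⟨y, hy, hmax⟩ := hK.exists_isMaxOn ⟨x, hx, by simp, by simpa using hxT⟩
    (continuous_finsetSum T fun e _ => continuous_apply e).continuousOn
  simp only [Set.mem_inter_iff, Set.mem_iInter, Set.mem_ofPred_eq, Set.mem_compl_iff,
    Finset.mem_coe] at hy
  obtain ⟨hyP, hxy, hyT⟩ := hy
  refine ⟨y, hyP, hxy, hyT, ?_⟩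
  have tight : ∀ e ∈ T, ∃ A : Finset E, e ∈ A ∧ ∑ d ∈ A, y d = f A := by
    intro e he
    by_contra! hno
    have hne : (Finset.univ.filter fun A : Finset E => e ∈ A).Nonempty := ⟨{e}, by simp⟩
    -- The coordinate at `e` can be raised by the least slack among the constraints that involve it.
    obtain ⟨A₀, hA₀, hmin⟩ := Finset.exists_min_image _ (fun A => f A - ∑ d ∈ A, y d) hne
    set ε := f A₀ - ∑ d ∈ A₀, y d with hε
    have hεpos : 0 < ε := sub_pos.2 (lt_of_le_of_ne (hyP.2 A₀) (hno A₀ (by simpa using hA₀)))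
    let z : E → ℝ := fun d => y d + if d = e then ε else 0
    have hsum : ∀ A : Finset E, ∑ d ∈ A, z d = ∑ d ∈ A, y d + if e ∈ A then ε else 0 := by
      intro A
      simp [z, Finset.sum_add_distrib]
    have hge : ∀ d, y d ≤ z d := by
      intro d
      simp only [z]
      split_ifs <;> linarith
    have hmem : z ∈ polytope f := by
      refine ⟨fun d => (hyP.1 d).trans (hge d), fun A => ?_⟩
      rw [hsum]
      split_ifs with hA
      · have := hmin A (by simpa using hA)
        linarith
      · simpa using hyP.2 A
    have := hmax (show z ∈ _ from ⟨hmem, by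
      simp only [Set.mem_inter_iff, Set.mem_iInter, Set.mem_ofPred_eq, Set.mem_compl_iff,
        Finset.mem_coe]
      refine ⟨fun d => (hxy d).trans (hge d), fun d hd => ?_⟩
      have hde : d ≠ e := fun h => hd (h ▸ he)
      simp [z, hyT d hd, hde]⟩)
    simp only [Set.mem_ofPred_eq, hsum, he, if_true] at this
    linarith
  have union : ∀ B : Finset E, B ⊆ T → ∃ A : Finset E, B ⊆ A ∧ ∑ d ∈ A, y d = f A := by
    intro B
    induction B using Finset.induction_on with
    | empty => exact fun _ => ⟨∅, by simp, by simp [hf.empty]⟩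
    | insert e B _ ih =>
      intro hB
      obtain ⟨A, hBA, hA⟩ := ih fun d hd => hB (Finset.mem_insert_of_mem hd)
      obtain ⟨A', heA, hA'⟩ := tight e (hB (Finset.mem_insert_self _ _))
      exact ⟨A' ∪ A, Finset.insert_subset (Finset.mem_union_left _ heA)
        (hBA.trans Finset.subset_union_right), hf.sum_union_eq hyP hA' hA⟩
  obtain ⟨A, hTA, hA⟩ := union T subset_rfl
  refine le_antisymm (hyP.2 T) ((hf.le_of_subset hTA).trans ?_)
  rw [← hA, ← one_dotProduct_eq_sum hyT]
  exact sum_le_one_dotProduct hyP A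

/-! ### Faces of the polytope -/

theorem one_dotProduct_restr (S : Finset E) (x : E → ℝ) :
    (1 : E → ℝ) ⬝ᵥ restr S x = ∑ e ∈ S, x e := by
  rw [one_dotProduct_eq_sum fun e he => restr_apply_of_notMem he x]
  exact Finset.sum_congr rfl fun e he => restr_apply_of_mem he x

theorem mem_maxFace_of_dotProduct_le {ι : Type*} [Fintype ι] {P : Set (ι → ℝ)} {u x y : ι → ℝ}
    (hx : x ∈ maxFace P u) (hy : y ∈ P) (h : u ⬝ᵥ x ≤ u ⬝ᵥ y) : y ∈ maxFace P u :=
  ⟨hy, fun z hz => (hx.2 z hz).trans h⟩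

variable {u x : E → ℝ}

theorem eq_zero_of_neg (hx : x ∈ maxFace (polytope f) u) {e : E} (he : u e < 0) : x e = 0 := by
  have h := hx.2 _ (restr_mem hx.1 (Finset.univ.erase e))
  have h1 : u ⬝ᵥ restr (Finset.univ.erase e) x = u ⬝ᵥ x - u e * x e := by
    have : restr (Finset.univ.erase e) x = x - Pi.single e (x e) := by
      ext d
      by_cases hd : d = e
      · subst hd
        simp [restr]
      · simp [restr, hd]
    rw [this, dotProduct_sub, dotProduct_single]
  rw [h1] at h
  have := hx.1.1 e
  nlinarith

theorem restr_mem_maxFace (hx : x ∈ maxFace (polytope f) u) {R : Finset E}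
    (hR : ∀ e, 0 < u e → e ∈ R) : restr R x ∈ maxFace (polytope f) u := by
  refine mem_maxFace_of_dotProduct_le hx (restr_mem hx.1 R) (Finset.sum_le_sum fun e _ => ?_)
  by_cases he : e ∈ R
  · rw [restr_apply_of_mem he]
  · rcases (not_lt.1 fun h => he (hR e h) : u e ≤ 0).eq_or_lt with h | h
    · simp [h]
    · simp [eq_zero_of_neg hx h, restr]

/-- All points of the face in direction `u` attain the bound for `{u > 0}`, since otherwise their
restriction to this set could be increased. -/
theorem IsPolymatroid.sum_pos_eq (hf : IsPolymatroid f) (hx : x ∈ maxFace (polytope f) u) :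
    ∑ e with 0 < u e, x e = f {e | 0 < u e} := by
  set S : Finset E := {e | 0 < u e} with hS
  have hz := restr_mem_maxFace (R := S) hx fun e he => by simpa [hS] using he
  obtain ⟨y, hy, hzy, hyS, hsum⟩ :=
    hf.exists_le_sum_eq hz.1 (T := S) fun e he => restr_apply_of_notMem he x
  have hle := hz.2 y hy
  have heq : ∀ e ∈ S, u e * restr S x e = u e * y e := by
    have hterm : ∀ e ∈ (Finset.univ : Finset E), u e * restr S x e ≤ u e * y e := by
      intro e _
      by_cases he : e ∈ S
      · exact mul_le_mul_of_nonneg_left (hzy e) (by simpa [hS] using he : 0 < u e).le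
      · rw [hyS e he, restr_apply_of_notMem he]
    exact fun e _ => (Finset.sum_eq_sum_iff_of_le hterm).1
      (le_antisymm (Finset.sum_le_sum hterm) hle) e (Finset.mem_univ e)
  rw [← hsum]
  refine Finset.sum_congr rfl fun e he => ?_
  have := mul_left_cancel₀ (by simpa [hS] using he : 0 < u e).ne' (heq e he)
  rwa [restr_apply_of_mem he] at this

/-- Coordinates with `u ≥ 0` can be increased within the face until they attain their bound. -/
theorem IsPolymatroid.exists_le_mem_maxFace (hf : IsPolymatroid f)
    (hx : x ∈ maxFace (polytope f) u) : ∃ y ∈ maxFace (polytope f) u, (∀ e, x e ≤ y e) ∧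
      (1 : E → ℝ) ⬝ᵥ y = f {e | 0 ≤ u e} := by
  obtain ⟨y, hy, hxy, hyT, hsum⟩ := hf.exists_le_sum_eq hx.1 (T := {e | 0 ≤ u e})
    fun e he => eq_zero_of_neg hx (by simpa using he)
  refine ⟨y, mem_maxFace_of_dotProduct_le hx hy (Finset.sum_le_sum fun e _ => ?_), hxy, ?_⟩
  · rcases le_or_gt 0 (u e) with h | h
    · exact mul_le_mul_of_nonneg_left (hxy e) h
    · rw [eq_zero_of_neg hx h, hyT e (by simpa using h)]
  · rw [one_dotProduct_eq_sum hyT, hsum]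

/-- The coordinate sum on the face in direction `u` ranges from `f {u > 0}` to `f {u ≥ 0}`. -/
theorem IsPolymatroid.hasRange_maxFace (hf : IsPolymatroid f) (u : E → ℝ) :
    HasRange 1 (maxFace (polytope f) u) (f {e | 0 < u e}) (f {e | 0 ≤ u e}) := by
  obtain ⟨x, hx⟩ := maxFace_nonempty (isCompact_polytope f) ⟨0, hf.zero_mem⟩ u
  refine ⟨⟨⟨restr {e | 0 < u e} x, restr_mem_maxFace hx fun e he => by simpa using he, ?_⟩, ?_⟩,
    ⟨?_, ?_⟩⟩
  · exact (one_dotProduct_restr _ x).trans (hf.sum_pos_eq hx)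
  · rintro _ ⟨y, hy, rfl⟩
    exact hf.sum_pos_eq hy ▸ sum_le_one_dotProduct hy.1 _
  · obtain ⟨y, hy, -, hy1⟩ := hf.exists_le_mem_maxFace hx
    exact ⟨y, hy, hy1⟩
  · rintro _ ⟨y, hy, rfl⟩
    have : ∀ e ∉ ({e | 0 ≤ u e} : Finset E), y e = 0 := fun e he =>
      eq_zero_of_neg hy (by simpa using he)
    exact (one_dotProduct_eq_sum this).trans_le (hy.1.2 _)

theorem maxFace_zero {ι : Type*} [Fintype ι] (P : Set (ι → ℝ)) : maxFace P 0 = P := by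
  ext
  simp [maxFace]

theorem IsPolymatroid.hasRange_polytope (hf : IsPolymatroid f) :
    HasRange 1 (polytope f) 0 (f Finset.univ) := by
  simpa [maxFace_zero, hf.empty] using hf.hasRange_maxFace 0

/-! ### The cellular string of a direction -/

/-- Above any upper level set `U` of `w`, the faces `P^(w - t)`, for those values `t` of `w` outside
`U` at which `f` increases, subdivide the interval from `f U` to `f E`. -/
theorem IsPolymatroid.exists_isWalk (hf : IsPolymatroid f) (w : E → ℝ) (U : Finset E)
    (hU : ∀ e ∈ U, ∀ d, w e ≤ w d → d ∈ U) :
    ∃ F, IsWalk 1 (f U) (f Finset.univ) F ∧ HasSlopes (polytope f) 1 w F := by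
  induction hn : Uᶜ.card using Nat.strong_induction_on generalizing U with
  | _ n ih =>
  subst hn
  rcases Uᶜ.eq_empty_or_nonempty with h | h
  · rw [Finset.compl_eq_empty_iff] at h
    subst h
    exact ⟨[], rfl, by simp [HasSlopes]⟩
  · obtain ⟨e₀, he₀, hmax⟩ := Finset.exists_max_image _ w h
    simp only [Finset.mem_compl] at he₀ hmax
    have hpos : ({e | 0 < (w + (-w e₀) • (1 : E → ℝ)) e} : Finset E) = U := by
      ext e
      simp only [Finset.mem_filter_univ, Pi.add_apply, Pi.smul_apply, Pi.one_apply, smul_eq_mul]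
      constructor
      · intro he
        by_contra heU
        linarith [hmax e heU]
      · intro he
        by_contra hle
        exact he₀ (hU e he e₀ (by linarith))
    have hsub : U ⊆ ({e | 0 ≤ (w + (-w e₀) • (1 : E → ℝ)) e} : Finset E) := by
      intro e he
      rw [← hpos] at he
      simp only [Finset.mem_filter_univ] at he ⊢
      exact he.le
    have hmem : e₀ ∈ ({e | 0 ≤ (w + (-w e₀) • (1 : E → ℝ)) e} : Finset E) := by simp
    obtain ⟨F, hF, hw⟩ := ih _ (Finset.card_lt_card (Finset.compl_ssubset_compl.2
      (Finset.ssubset_iff_of_subset hsub |>.2 ⟨e₀, hmem, he₀⟩))) _ (fun e he d hed => by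
        simp only [Finset.mem_filter_univ, Pi.add_apply, Pi.smul_apply, Pi.one_apply,
          smul_eq_mul] at he ⊢
        linarith) rfl
    rcases (hf.le_of_subset hsub).eq_or_lt with heq | hlt
    · exact ⟨F, heq ▸ hF, hw⟩
    · refine ⟨maxFace (polytope f) (w + (-w e₀) • (1 : E → ℝ)) :: F, ⟨_, hlt, ?_, hF⟩, ?_⟩
      · have := hf.hasRange_maxFace (w + (-w e₀) • (1 : E → ℝ))
        rwa [hpos] at this
      · simp only [HasSlopes, List.forall_mem_cons]
        exact ⟨⟨_, rfl⟩, hw⟩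

theorem IsPolymatroid.exists_isCellularString (hf : IsPolymatroid f) (h0 : 0 < f Finset.univ)
    (w : E → ℝ) :
    ∃ F, IsCellularString (polytope f) 1 F ∧ HasSlopes (polytope f) 1 w F := by
  obtain ⟨F, hF, hw⟩ := hf.exists_isWalk w ∅ (by simp)
  rw [hf.empty] at hF
  exact ⟨F, hF.isCellularString (isCompact_polytope f) ⟨0, hf.zero_mem⟩ hf.hasRange_polytope h0
    subset_rfl hw.isFace (fun C hC => (hw.isFace C hC).subset) (hF.isChain_consecutive hw), hw⟩

/-! ### Every cellular string comes from a direction -/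

theorem support_subset {u : E → ℝ} :
    support (maxFace (polytope f) u) ⊆ ({e | 0 ≤ u e} : Finset E) := by
  intro e he
  simp only [support, Finset.mem_filter_univ] at he ⊢
  obtain ⟨x, hx, hxe⟩ := he
  by_contra! h
  exact hxe (eq_zero_of_neg hx h)

/-- On a face, the coordinate sum is maximal where it attains the bound for the support. -/
theorem IsPolymatroid.mem_maxFace_one_iff (hf : IsPolymatroid f) {F : Set (E → ℝ)}
    (hF : IsFace (polytope f) F) : x ∈ maxFace F 1 ↔
      x ∈ F ∧ ∑ e ∈ support F, x e = f (support F) := by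
  obtain ⟨u, rfl⟩ := hF
  have hr := hf.hasRange_maxFace u
  rw [hr.mem_maxFace]
  have hsum : ∀ y ∈ maxFace (polytope f) u, (1 : E → ℝ) ⬝ᵥ y =
      ∑ e ∈ support (maxFace (polytope f) u), y e := fun y hy =>
    one_dotProduct_eq_sum fun e he => eq_zero_of_notMem_support hy he
  obtain ⟨y, hy⟩ := hr.exists_maxFace
  rw [hr.mem_maxFace] at hy
  have h1 : f (support (maxFace (polytope f) u)) = f {e | 0 ≤ u e} := by
    refine le_antisymm (hf.le_of_subset support_subset) ?_
    rw [← hy.2, hsum y hy.1]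
    exact hy.1.1.2 _
  refine and_congr_right fun hx => ?_
  rw [hsum x hx, h1]

/-- The maximal points of a face have full support. -/
theorem IsPolymatroid.support_maxFace_one (hf : IsPolymatroid f) {F : Set (E → ℝ)}
    (hF : IsFace (polytope f) F) : support F ⊆ support (maxFace F 1) := by
  obtain ⟨u, rfl⟩ := hF
  intro e he
  simp only [support, Finset.mem_filter_univ] at he ⊢
  obtain ⟨x, hx, hxe⟩ := he
  obtain ⟨y, hy, hxy, hy1⟩ := hf.exists_le_mem_maxFace hx
  refine ⟨y, (hf.hasRange_maxFace u).mem_maxFace.2 ⟨hy, hy1⟩, ?_⟩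
  exact (((hx.1.1 e).lt_of_ne' hxe).trans_le (hxy e)).ne'

/-- A point with support in that of a face belongs to the face as soon as one of its restrictions
does. -/
theorem mem_of_restr_mem {F : Set (E → ℝ)} (hF : IsFace (polytope f) F) {R : Finset E}
    (hx : x ∈ polytope f) (hR : restr R x ∈ F) (hsupp : ∀ e ∉ support F, x e = 0) : x ∈ F := by
  obtain ⟨u, rfl⟩ := hF
  refine mem_maxFace_of_dotProduct_le hR hx (Finset.sum_le_sum fun e _ => ?_)
  by_cases he : e ∈ support (maxFace (polytope f) u)
  · exact mul_le_mul_of_nonneg_left (restr_le hx R e) (by simpa using support_subset he)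
  · have h0 := hsupp e he
    simp [restr, h0]

/-- The members of a cellular string are determined by their supports. -/
theorem IsPolymatroid.mem_member_iff (hf : IsPolymatroid f) {G : ℕ → Set (E → ℝ)} {n : ℕ}
    (hface : ∀ i < n, IsFace (polytope f) (G i)) (hfirst : minFace (G 0) 1 ⊆ {0})
    (hstep : ∀ i, i + 1 < n → maxFace (G i) 1 = minFace (G (i + 1)) 1) {i : ℕ} (hi : i < n) :
    x ∈ G i ↔ x ∈ polytope f ∧ (∀ j < i, ∑ e ∈ support (G j), x e = f (support (G j))) ∧
      ∀ j, i ≤ j → j < n → ∀ e ∉ support (G j), x e = 0 := by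
  have hmono : ∀ i j, i ≤ j → j < n → support (G i) ⊆ support (G j) := by
    intro i j hij hj
    induction j, hij using Nat.le_induction with
    | base => exact subset_rfl
    | succ j hij ih =>
      refine (ih (by omega)).trans ((hf.support_maxFace_one (hface j (by omega))).trans ?_)
      rw [hstep j hj]
      intro e he
      simp only [support, Finset.mem_filter_univ] at he ⊢
      obtain ⟨x, hx, hxe⟩ := he
      exact ⟨x, hx.1, hxe⟩
  have hmin : ∀ i < n, ∀ y ∈ G i, ∃ R, restr R y ∈ minFace (G i) 1 := by
    intro i hi y hy
    obtain ⟨u, hu⟩ := hface i hi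
    rw [hu] at hy ⊢
    refine ⟨({e | 0 < u e} : Finset E), (hf.hasRange_maxFace u).mem_minFace.2
      ⟨restr_mem_maxFace hy fun e he => by simpa using he, ?_⟩⟩
    rw [one_dotProduct_restr, hf.sum_pos_eq hy]
  constructor
  · intro hx
    refine ⟨(hface i hi).subset hx, fun j hj => ?_, fun j hij hj e he =>
      eq_zero_of_notMem_support hx fun h => he (hmono i j hij hj h)⟩
    induction i generalizing x with
    | zero => omega
    | succ i ih =>
      obtain ⟨R, hR⟩ := hmin _ hi x hx
      rw [← hstep i hi, hf.mem_maxFace_one_iff (hface i (by omega))] at hR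
      refine le_antisymm (((hface _ hi).subset hx).2 _) ?_
      have hle := Finset.sum_le_sum fun e (_ : e ∈ support (G j)) =>
        restr_le ((hface _ hi).subset hx) R e
      refine le_trans (Eq.ge ?_) hle
      rcases Nat.lt_succ_iff_lt_or_eq.1 hj with hj' | rfl
      · exact ih (by omega) hR.1 hj'
      · exact hR.2
  · rintro ⟨hxP, htight, hzero⟩
    induction i generalizing x with
    | zero =>
      obtain ⟨y, hy⟩ : (minFace (G 0) 1).Nonempty := by
        obtain ⟨y, hy⟩ := (hface 0 hi).nonempty (isCompact_polytope f) ⟨0, hf.zero_mem⟩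
        obtain ⟨R, hR⟩ := hmin 0 hi y hy
        exact ⟨_, hR⟩
      have hy0 : y = 0 := hfirst hy
      refine mem_of_restr_mem (R := ∅) (hface 0 hi) hxP ?_ (hzero 0 le_rfl hi)
      have : restr ∅ x = (0 : E → ℝ) := by
        ext
        simp [restr]
      rw [this, ← hy0]
      exact hy.1
    | succ i ih =>
      have hsum : ∀ j ≤ i, ∑ e ∈ support (G j), restr (support (G i)) x e =
          f (support (G j)) := by
        intro j hj
        rw [← htight j (by omega)]
        exact Finset.sum_congr rfl fun e he =>
          restr_apply_of_mem (hmono j i hj (by omega) he) x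
      have hmem : restr (support (G i)) x ∈ G i := by
        refine ih (by omega) (restr_mem hxP _) (fun j hj => hsum j hj.le) fun j hij hj e he => ?_
        exact restr_apply_of_notMem (fun h => he (hmono i j hij hj h)) x
      have hmax := (hf.mem_maxFace_one_iff (hface i (by omega))).2 ⟨hmem, hsum i le_rfl⟩
      rw [hstep i hi] at hmax
      exact mem_of_restr_mem (hface _ hi) hxP hmax.1 (hzero _ le_rfl hi)

/-- The direction that penalizes every element by the number of supports `T j`, `j < n`, that do
not contain it. -/
def supportDirection (T : ℕ → Finset E) (n : ℕ) : E → ℝ :=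
  fun e => -∑ j ∈ Finset.range n, if e ∈ T j then 0 else 1

theorem supportDirection_add_dotProduct (T : ℕ → Finset E) {n i : ℕ} (hi : i ≤ n) (x : E → ℝ) :
    (supportDirection T n + (i : ℝ) • (1 : E → ℝ)) ⬝ᵥ x =
      ∑ j ∈ Finset.range i, ∑ e ∈ T j, x e - ∑ j ∈ Finset.Ico i n, ∑ e ∈ (T j)ᶜ, x e := by
  have h1 : supportDirection T n ⬝ᵥ x = -∑ j ∈ Finset.range n, ∑ e ∈ (T j)ᶜ, x e := by
    simp only [supportDirection, dotProduct, neg_mul, Finset.sum_neg_distrib, Finset.sum_mul]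
    rw [Finset.sum_comm]
    congr 1
    refine Finset.sum_congr rfl fun j _ => ?_
    rw [← Finset.sum_filter_add_sum_filter_not Finset.univ (fun e => e ∈ T j)]
    rw [Finset.sum_eq_zero fun e he => by simp [(Finset.mem_filter.1 he).2], zero_add]
    refine Finset.sum_congr (by ext; simp) fun e he => ?_
    simp [Finset.mem_compl.1 he]
  have h2 : (i : ℝ) * ((1 : E → ℝ) ⬝ᵥ x) =
      ∑ j ∈ Finset.range i, (∑ e ∈ T j, x e + ∑ e ∈ (T j)ᶜ, x e) := by
    simp [Finset.sum_add_sum_compl, one_dotProduct]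
  rw [add_dotProduct, smul_dotProduct, smul_eq_mul, h1, h2, Finset.sum_add_distrib,
    ← Finset.sum_range_add_sum_Ico _ hi]
  ring

/-- Every cellular string consists of faces `P^(w + t)` for a single direction `w`. -/
theorem IsPolymatroid.exists_hasSlopes (hf : IsPolymatroid f) {F : List (Set (E → ℝ))}
    (hF : IsCellularString (polytope f) 1 F) : ∃ w, HasSlopes (polytope f) 1 w F := by
  set G : ℕ → Set (E → ℝ) := fun i => F.getD i ∅ with hG
  have hGi : ∀ i (hi : i < F.length), G i = F[i] := fun i hi => by simp [hG, hi]
  have hface : ∀ i < F.length, IsFace (polytope f) (G i) := fun i hi => by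
    rw [hGi i hi]
    exact hF.isFace _ (List.getElem_mem hi)
  have hfirst : minFace (G 0) 1 ⊆ {0} := by
    rw [hGi 0 (List.length_pos_iff.2 hF.ne_nil), ← List.head_eq_getElem hF.ne_nil]
    intro x hx
    have h := hf.hasRange_polytope.mem_minFace.1 (hF.first hx)
    rw [one_dotProduct, Finset.sum_eq_zero_iff_of_nonneg fun e _ => h.1.1 e] at h
    exact funext fun e => h.2 e (Finset.mem_univ e)
  have hstep : ∀ i, i + 1 < F.length → maxFace (G i) 1 = minFace (G (i + 1)) 1 := by
    intro i hi
    have := List.isChain_iff_getElem.1 hF.chain i hi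
    rw [hGi i (by omega), hGi _ hi]
    exact this.1.trans this.2
  refine ⟨supportDirection (fun j => support (G j)) F.length, fun C hC => ?_⟩
  obtain ⟨i, hi, rfl⟩ := List.getElem_of_mem hC
  refine ⟨i, ?_⟩
  rw [← hGi i hi]
  have hval := supportDirection_add_dotProduct (fun j => support (G j)) hi.le
  have hiff := fun x => hf.mem_member_iff (x := x) hface hfirst hstep hi
  have hbound : ∀ z ∈ polytope f, (∑ j ∈ Finset.range i, ∑ e ∈ support (G j), z e ≤
      ∑ j ∈ Finset.range i, f (support (G j))) ∧
      0 ≤ ∑ j ∈ Finset.Ico i F.length, ∑ e ∈ (support (G j))ᶜ, z e := fun z hz =>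
    ⟨Finset.sum_le_sum fun j _ => hz.2 _,
      Finset.sum_nonneg fun j _ => Finset.sum_nonneg fun e _ => hz.1 e⟩
  have hattain : ∀ y ∈ G i, (supportDirection (fun j => support (G j)) F.length +
      (i : ℝ) • (1 : E → ℝ)) ⬝ᵥ y = ∑ j ∈ Finset.range i, f (support (G j)) := by
    intro y hy
    obtain ⟨-, h1, h2⟩ := (hiff y).1 hy
    rw [hval, Finset.sum_congr rfl fun j hj => h1 j (Finset.mem_range.1 hj),
      Finset.sum_eq_zero (s := Finset.Ico i F.length), sub_zero]
    intro j hj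
    rw [Finset.mem_Ico] at hj
    exact Finset.sum_eq_zero fun e he => h2 j hj.1 hj.2 e (Finset.mem_compl.1 he)
  ext x
  constructor
  · intro hx
    refine ⟨(hface i hi).subset hx, fun z hz => ?_⟩
    rw [hattain x hx, hval]
    linarith [hbound z hz]
  · intro hx
    obtain ⟨y, hy⟩ := (hface i hi).nonempty (isCompact_polytope f) ⟨0, hf.zero_mem⟩
    have h := hx.2 y ((hface i hi).subset hy)
    rw [hattain y hy, hval] at h
    obtain ⟨hb1, hb2⟩ := hbound x hx.1
    refine (hiff x).2 ⟨hx.1, fun j hj => ?_, fun j hij hj e he => ?_⟩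
    · exact (Finset.sum_eq_sum_iff_of_le fun j _ => hx.1.2 (support (G j))).1
        (le_antisymm hb1 (by linarith)) j (Finset.mem_range.2 hj)
    · have h0 := (Finset.sum_eq_zero_iff_of_nonneg fun j _ =>
        Finset.sum_nonneg fun e _ => hx.1.1 e).1 (le_antisymm (by linarith) hb2) j
        (Finset.mem_Ico.2 ⟨hij, hj⟩)
      exact (Finset.sum_eq_zero_iff_of_nonneg fun e _ => hx.1.1 e).1 h0 e
        (Finset.mem_compl.2 he)

end PolymatroidFaces

section MonotonePathsOfPolymatroids

variable {E : Type*} [Fintype E] [DecidableEq E] {f : Finset E → ℝ}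

/-! ### Monotone paths are greedy paths -/

theorem eq_left_of_mem_segment {ι : Type*} [Fintype ι] {c x y z : ι → ℝ}
    (hz : z ∈ segment ℝ x y) (hxy : c ⬝ᵥ x < c ⬝ᵥ y) (h : c ⬝ᵥ z ≤ c ⬝ᵥ x) : z = x := by
  obtain ⟨r, s, hr, hs, hrs, rfl⟩ := hz
  obtain rfl : r = 1 - s := by linarith
  simp only [dotProduct_add, dotProduct_smul, smul_eq_mul] at h
  obtain rfl : s = 0 := by nlinarith
  simp

theorem le_right_of_mem_segment {ι : Type*} [Fintype ι] {c x y z : ι → ℝ}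
    (hz : z ∈ segment ℝ x y) (hxy : c ⬝ᵥ x < c ⬝ᵥ y) : c ⬝ᵥ z ≤ c ⬝ᵥ y := by
  obtain ⟨r, s, hr, hs, hrs, rfl⟩ := hz
  obtain rfl : r = 1 - s := by linarith
  simp only [dotProduct_add, dotProduct_smul, smul_eq_mul]
  nlinarith

/-- Along an increasing edge only one coordinate changes. It vanishes before, and it attains its
greedy value afterwards. -/
theorem IsPolymatroid.exists_of_isFace_segment (hf : IsPolymatroid f) {x y : E → ℝ}
    (hface : IsFace (polytope f) (segment ℝ x y))
    (hxy : (1 : E → ℝ) ⬝ᵥ x < (1 : E → ℝ) ⬝ᵥ y) :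
    ∃ a, x a = 0 ∧ 0 < y a ∧ (∀ e ≠ a, y e = x e) ∧
      ∀ J : Finset E, (∀ e ∉ J, x e = 0) → ∑ e ∈ J, x e = f J → a ∉ J →
        y a = f (insert a J) - f J := by
  obtain ⟨u, hu⟩ := hface
  have hx : x ∈ maxFace (polytope f) u := hu ▸ left_mem_segment ℝ x y
  have hy : y ∈ maxFace (polytope f) u := hu ▸ right_mem_segment ℝ x y
  have hS : restr {e | 0 < u e} y = x := by
    refine eq_left_of_mem_segment (hu ▸ restr_mem_maxFace hy fun e he => by simpa using he) hxy ?_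
    rw [one_dotProduct_restr, hf.sum_pos_eq hy]
    exact (hf.hasRange_maxFace u).le hx
  obtain ⟨a, ha⟩ : ∃ a, y a ≠ x a := by
    by_contra! h
    exact hxy.ne (by rw [funext h])
  have hua : ¬0 < u a := by
    intro h
    rw [← hS, restr_apply_of_mem (by simpa using h)] at ha
    exact ha rfl
  have hxa : x a = 0 := by
    rw [← hS]
    exact restr_apply_of_notMem (by simpa using hua) y
  rw [hxa] at ha
  have hya : 0 < y a := (hy.1.1 a).lt_of_ne' ha
  have hua0 : u a = 0 := le_antisymm (not_lt.1 hua) (not_lt.1 fun h => ha (eq_zero_of_neg hy h))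
  have hR : restr (insert a ({e | 0 < u e} : Finset E)) y = y := by
    have hmem : restr (insert a ({e | 0 < u e} : Finset E)) y ∈ segment ℝ x y :=
      hu ▸ restr_mem_maxFace hy fun e he => by simp [he]
    obtain ⟨r, s, hr, hs, hrs, h⟩ := hmem
    have h' := congrFun h a
    rw [restr_apply_of_mem (Finset.mem_insert_self _ _)] at h'
    simp only [Pi.add_apply, Pi.smul_apply, hxa, smul_eq_mul, mul_zero, zero_add] at h'
    obtain rfl : s = 1 := mul_right_cancel₀ ha (by rw [h', one_mul])
    obtain rfl : r = 0 := by linarith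
    rw [← h]
    simp
  have heq : ∀ e ≠ a, y e = x e := by
    intro e he
    rw [← hR, ← hS]
    simp only [restr, Finset.mem_insert, he, false_or]
  refine ⟨a, hxa, hya, heq, fun J hxJ hJ haJ => ?_⟩
  have hysum : ∑ e ∈ J, y e = f J := by
    rw [← hJ]
    exact Finset.sum_congr rfl fun e he => heq e fun h => haJ (h ▸ he)
  have hy0 : ∀ e ∉ insert a J, y e = 0 := by
    intro e he
    rw [Finset.mem_insert, not_or] at he
    rw [heq e he.1, hxJ e he.2]
  obtain ⟨z, hz, hyz, hz0, hzsum⟩ := hf.exists_le_sum_eq hy.1 hy0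
  have hzJ : ∀ e ∈ J, y e = z e := (Finset.sum_eq_sum_iff_of_le fun e _ => hyz e).1
    (le_antisymm (Finset.sum_le_sum fun e _ => hyz e) (hysum ▸ hz.2 J))
  have hzF : z ∈ maxFace (polytope f) u := by
    refine mem_maxFace_of_dotProduct_le hy hz (Finset.sum_le_sum fun e _ => ?_)
    by_cases he : e = a
    · simp [he, hua0]
    · by_cases heJ : e ∈ J
      · rw [hzJ e heJ]
      · have : e ∉ insert a J := by simp [he, heJ]
        rw [hy0 e this, hz0 e this]
  have hle := le_right_of_mem_segment (hu ▸ hzF) hxy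
  rw [one_dotProduct_eq_sum hz0, hzsum, one_dotProduct_eq_sum hy0] at hle
  have := le_antisymm (hy.1.2 _) hle
  rw [Finset.sum_insert haJ, hysum] at this
  linarith

theorem IsPolymatroid.flatClosure_eq (hf : IsPolymatroid f) (A : Finset E) :
    f (flatClosure f A) = f A := by
  have hA : A ⊆ flatClosure f A := fun e he => by
    simp [flatClosure, Finset.insert_eq_of_mem he]
  have key : ∀ B : Finset E, B ⊆ flatClosure f A → f (A ∪ B) = f A := by
    intro B
    induction B using Finset.induction_on with
    | empty => simp
    | insert e B _ ih =>
      intro hB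
      have h1 := ih fun d hd => hB (Finset.mem_insert_of_mem hd)
      have h2 : f (insert e A) = f A := by
        simpa [flatClosure] using hB (Finset.mem_insert_self e B)
      have h3 := hf.submodular (insert e A) (A ∪ B)
      have h4 : f A ≤ f (insert e A ∩ (A ∪ B)) := hf.le_of_subset
        (Finset.subset_inter (Finset.subset_insert _ _) Finset.subset_union_left)
      have h5 : insert e A ∪ (A ∪ B) = A ∪ insert e B := by
        ext
        simp only [Finset.mem_union, Finset.mem_insert]
        tauto
      rw [h5] at h3
      have h6 : f A ≤ f (A ∪ insert e B) := hf.le_of_subset Finset.subset_union_left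
      linarith
  have := key _ subset_rfl
  rwa [Finset.union_eq_right.2 hA] at this

theorem IsPolymatroid.greedyPoint_apply (hf : IsPolymatroid f) (j : List E) (i : ℕ) (e : E) :
    greedyPoint f j i e = if e ∈ j.take i then
      f (j.take (j.idxOf e + 1)).toFinset - f (j.take (j.idxOf e)).toFinset else 0 := by
  simp only [greedyPoint, greedyFlat, hf.flatClosure_eq]

theorem IsPolymatroid.greedyPoint_concat (hf : IsPolymatroid f) (j : List E) (a : E) {i : ℕ}
    (hi : i ≤ j.length) : greedyPoint f (j ++ [a]) i = greedyPoint f j i := by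
  ext e
  rw [hf.greedyPoint_apply, hf.greedyPoint_apply, List.take_append_of_le_length hi]
  split_ifs with h
  · have hj := List.mem_of_mem_take h
    have hlt := List.idxOf_lt_length_of_mem hj
    rw [List.idxOf_append_of_mem hj, List.take_append_of_le_length hlt,
      List.take_append_of_le_length hlt.le]
  · rfl

/-- The members of a monotone path, starting from the origin, are the points given by the list of
the coordinates that have been raised. -/
theorem IsPolymatroid.exists_greedyPoint (hf : IsPolymatroid f) (v : List (E → ℝ)) (hv : v ≠ [])
    (h0 : v.head hv = 0) (hch : v.IsChain fun x y => IsFace (polytope f) (segment ℝ x y) ∧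
      (1 : E → ℝ) ⬝ᵥ x < (1 : E → ℝ) ⬝ᵥ y) :
    ∃ j : List E, j.Nodup ∧ v = (List.range (j.length + 1)).map (greedyPoint f j) ∧
      v.getLast hv = greedyPoint f j j.length ∧
      (∀ e ∈ j, 0 < greedyPoint f j j.length e) ∧
      ∑ e ∈ j.toFinset, greedyPoint f j j.length e = f j.toFinset := by
  induction v using List.reverseRecOn with
  | nil => exact absurd rfl hv
  | append_singleton v y ih =>
    rcases eq_or_ne v [] with rfl | hne
    · have h : greedyPoint f ([] : List E) 0 = 0 := by
        ext
        simp [greedyPoint]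
      obtain rfl : y = 0 := by simpa using h0
      exact ⟨[], List.nodup_nil, by simp [h], by simp [h], by simp, by simp [hf.empty]⟩
    · rw [List.isChain_append] at hch
      obtain ⟨j, hj, hvj, hlast, hpos, hsum⟩ := ih hne (by rwa [List.head_append_of_ne_nil] at h0)
        hch.1
      obtain ⟨hface, hlt⟩ := hch.2.2 _ (List.getLast?_eq_some_getLast hne) y (by simp)
      rw [hlast] at hface hlt
      obtain ⟨a, ha0, hya, heq, hval⟩ := hf.exists_of_isFace_segment hface hlt
      have haj : a ∉ j := fun h => (hpos a h).ne' ha0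
      have hoff : ∀ e ∉ j.toFinset, greedyPoint f j j.length e = 0 := by
        intro e he
        rw [hf.greedyPoint_apply, if_neg]
        simpa using he
      have hval' := hval j.toFinset hoff hsum (by simpa using haj)
      have hset : (j ++ [a]).toFinset = insert a j.toFinset := by
        ext
        simp
      have hy : y = greedyPoint f (j ++ [a]) (j ++ [a]).length := by
        ext e
        rw [hf.greedyPoint_apply, List.take_length]
        by_cases he : e = a
        · subst he
          have hidx : (j ++ [e]).idxOf e = j.length := by
            rw [List.idxOf_append_of_notMem haj]
            simp
          rw [hidx, if_pos (by simp), hval', List.take_append_of_le_length le_rfl, List.take_length,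
            List.take_of_length_le (by simp), hset]
        · rw [heq e he]
          by_cases hej : e ∈ j
          · have hidx := List.idxOf_append_of_mem (l₂ := [a]) hej
            have hlt := List.idxOf_lt_length_of_mem hej
            rw [if_pos (by simp [hej]), hidx, List.take_append_of_le_length hlt,
              List.take_append_of_le_length hlt.le, hf.greedyPoint_apply, List.take_length,
              if_pos hej]
          · rw [if_neg (by simp [hej, he]), hoff e (by simpa using hej)]
      refine ⟨j ++ [a], ?_, ?_, ?_, ?_, ?_⟩
      · exact List.nodup_append.2 ⟨hj, List.nodup_singleton a, by
          rintro e he d hd rfl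
          exact haj (List.mem_singleton.1 hd ▸ he)⟩
      · rw [List.range_succ, List.map_append, List.map_singleton, ← hy]
        congr 1
        rw [hvj, List.length_append, List.length_singleton]
        refine List.map_congr_left fun i hi => (hf.greedyPoint_concat j a ?_).symm
        rw [List.mem_range] at hi
        omega
      · rw [List.getLast_append_singleton, ← hy]
      · rw [← hy]
        intro e he
        by_cases hea : e = a
        · exact hea ▸ hya
        · rw [heq e hea]
          exact hpos e (by simpa [hea] using he)
      · rw [← hy, hset, Finset.sum_insert (by simpa using haj), hval',
          Finset.sum_congr rfl fun e he => heq e fun h => haj (by simpa [h] using he), hsum]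
        ring

/-- A list of distinct elements that ends at full rank is the support of the greedy vertex for a
weight that decreases along the list and ranks all other elements below it. -/
theorem IsPolymatroid.isGreedyPath (hf : IsPolymatroid f) {j : List E} (hj : j.Nodup)
    (hpos : ∀ e ∈ j, 0 < greedyPoint f j j.length e) (hfull : f j.toFinset = f Finset.univ) :
    IsGreedyPath f ((List.range (j.length + 1)).map (greedyPoint f j)) := by
  let g : E → ℕ := fun e => if e ∈ j then j.idxOf e else j.length + Fintype.equivFin E e
  have hgj : ∀ e ∈ j, g e = j.idxOf e := fun e he => if_pos he
  have hgn : ∀ e ∉ j, g e = j.length + Fintype.equivFin E e := fun e he => if_neg he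
  have hidx : ∀ e ∈ j, j.idxOf e < j.length := fun e he => List.idxOf_lt_length_of_mem he
  have hginj : Function.Injective g := by
    intro e d h
    by_cases he : e ∈ j <;> by_cases hd : d ∈ j
    · rw [hgj e he, hgj d hd] at h
      exact (List.idxOf_inj he).1 h
    · rw [hgj e he, hgn d hd] at h
      have := hidx e he
      omega
    · rw [hgn e he, hgj d hd] at h
      have := hidx d hd
      omega
    · rw [hgn e he, hgn d hd] at h
      exact (Fintype.equivFin E).injective (Fin.ext (by omega))
  have htake : ∀ k ≤ j.length, ({d | g d < k} : Finset E) = (j.take k).toFinset := by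
    intro k hk
    ext d
    rw [Finset.mem_filter_univ, List.mem_toFinset]
    by_cases hd : d ∈ j
    · rw [List.mem_take_iff_idxOf_lt hd, hgj d hd]
    · rw [hgn d hd]
      exact ⟨fun h => by omega, fun h => absurd (List.mem_of_mem_take h) hd⟩
  have hvertex : ∀ e, greedyVertex f (fun e => -(g e : ℝ)) e =
      f ({d | g d < g e + 1} : Finset E) - f ({d | g d < g e} : Finset E) := by
    intro e
    simp only [greedyVertex, neg_le_neg_iff, neg_lt_neg_iff, Nat.cast_le, Nat.cast_lt,
      Nat.lt_succ_iff]
  refine ⟨fun e => -(g e : ℝ), fun e d h => hginj (by simpa using h), j, fun e => ?_, ?_, rfl⟩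
  · rw [hvertex]
    by_cases he : e ∈ j
    · have hlt := hidx e he
      have := hpos e he
      rw [hf.greedyPoint_apply, List.take_length, if_pos he] at this
      rw [hgj e he, htake _ hlt, htake _ hlt.le]
      exact iff_of_true he this
    · have hbig : ∀ k, j.length ≤ k → f ({d | g d < k} : Finset E) = f Finset.univ := by
        intro k hk
        refine le_antisymm (hf.le_of_subset (Finset.subset_univ _)) ?_
        rw [← hfull]
        refine hf.le_of_subset fun d hd => ?_
        rw [List.mem_toFinset] at hd
        rw [Finset.mem_filter_univ, hgj d hd]
        exact (hidx d hd).trans_le hk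
      have hge : j.length ≤ g e := by
        rw [hgn e he]
        exact Nat.le_add_right _ _
      rw [hbig _ hge, hbig _ (hge.trans (Nat.le_succ _)), sub_self]
      exact iff_of_false he (lt_irrefl _)
  · rw [List.pairwise_iff_getElem]
    intro i k hi hk hik
    beta_reduce
    rw [hgj _ (List.getElem_mem hi), hgj _ (List.getElem_mem hk), hj.idxOf_getElem,
      hj.idxOf_getElem]
    exact neg_lt_neg (Nat.cast_lt.2 hik)

theorem IsMonotonePath.isGreedyPath (hf : IsPolymatroid f) {v : List (E → ℝ)}
    (hv : IsMonotonePath (polytope f) 1 v) : IsGreedyPath f v := by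
  have hr := hf.hasRange_polytope
  have h0 : v.head hv.ne_nil = 0 := by
    have h := hr.mem_minFace.1 (hv.first.subset rfl)
    rw [one_dotProduct, Finset.sum_eq_zero_iff_of_nonneg fun e _ => h.1.1 e] at h
    exact funext fun e => h.2 e (Finset.mem_univ e)
  obtain ⟨j, hj, hvj, hlast, hpos, hsum⟩ := hf.exists_greedyPoint v hv.ne_nil h0 hv.chain
  rw [hvj]
  refine hf.isGreedyPath hj hpos ?_
  have h1 := (hr.mem_maxFace.1 (hv.last.subset rfl)).2
  rw [hlast] at h1
  rw [← hsum, ← h1, one_dotProduct_eq_sum fun e he => ?_]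
  rw [hf.greedyPoint_apply, if_neg]
  simpa using he

end MonotonePathsOfPolymatroids

end MonotonePaths

open MonotonePaths
theorem theorem3p1 {E : Type*} [Fintype E] [DecidableEq E] (f : Finset E → ℝ)
    (hf : IsPolymatroid f) (hc : NotConstantOn (1 : E → ℝ) (polytope f)) :
    (∀ F : List (Set (E → ℝ)), IsCellularString (polytope f) 1 F → IsCoherent (polytope f) 1 F) ∧
    (∀ v : List (E → ℝ), IsMonotonePath (polytope f) 1 v → IsGreedyPath f v) ∧
    Nonempty (Baues (polytope f) 1 ≃o Faces (monotonePathPolytope (polytope f) (1 : E → ℝ))) := by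
  have hr := hf.hasRange_polytope
  have h0 : 0 < f Finset.univ := hr.notConstantOn_iff.1 hc
  refine ⟨fun F hF => ?_, fun v hv => hv.isGreedyPath hf, ?_⟩
  · obtain ⟨w, hw⟩ := hf.exists_hasSlopes hF
    exact ⟨w, hF.isCoherentFor (isCompact_polytope f) (convex_polytope f) hr h0 hw⟩
  · exact nonempty_baues_orderIso (isCompact_polytope f) (convex_polytope f) hr h0
      (fun F hF => hf.exists_hasSlopes hF) (hf.exists_isCellularString h0)
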